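/- **Theorem (limiting distribution of composite quantile regression).** Let $p\ge 0$, $K\ge 1$ and $0<\tau_1<\dots<\tau_K<1$. Let $\varepsilon_1,\varepsilon_2,\dots$ be independent, identically distributed real random variables with cumulative distribution function $F$ and a density $f$ with $f(t)>0$ for every $t\in\mathbb R$; for $0<\tau<1$ let $b^*_\tau$ be the $\tau$-quantile of this law, $F(b^*_\tau)=\tau$. For each $n$ let $\mathbf X_n$ be a deterministic $n\times p$ design matrix with rows $\mathbf x_{n,1}^T,\dots,\mathbf x_{n,n}^T$, let $\beta^*\in\mathbb R^p$, and let $y_{n,i}=\mathbf x_{n,i}^T\beta^*+\varepsilon_i$ for $1\le i\le n$. Assume: 1. $\lim_{n\to\infty}\frac1n\mathbf X_n^T\mathbf X_n=\mathbf C$ for a positive definite $p\times p$ matrix $\mathbf C$; 2. for all $a,u_0\in\mathbb R$ and $\mathbf u\in\mathbb R^p$, $$\lim_{n\to\infty}\frac1n\sum_{i=1}^n\int_0^{u_0+\mathbf x_{n,i}^T\mathbf u}\sqrt n\,\bigl[F(a+t/\sqrt n)-F(a)\bigr]\,dt=\frac12 f(a)\,(u_0,\mathbf u^T)\begin{bmatrix}1&0\\0&\mathbf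 C\end{bmatrix}(u_0,\mathbf u^T)^T .$$ With $\rho_\tau(t)=\tau t_++(1-\tau)t_-$, where $t_+=\max(t,0)$ and $t_-=\max(-t,0)$, let $\hat\beta^{\mathrm{CQR}}_n$ be any (measurable) composite quantile regression estimator, that is, almost surely, for some $\hat b_1,\dots,\hat b_K$, the tuple $(\hat b_1,\dots,\hat b_K,\hat\beta^{\mathrm{CQR}}_n)$ minimizes $$\sum_{k=1}^K\sum_{i=1}^n\rho_{\tau_k}\bigl(y_{n,i}-b_k-\mathbf x_{n,i}^T\beta\bigr)$$ over $(b_1,\dots,b_K)\in\mathbb R^K$, $\beta\in\mathbb R^p$. Then $\hat\beta^{\mathrm{CQR}}_n$ is root-$n$ consistent, i.e. $\sqrt n(\hat\beta^{\mathrm{CQR}}_n-\beta^*)$ is bounded in probability, and $$\sqrt n\,(\hat\beta^{\mathrm{CQR}}_n-\beta^*)\to_d N(0,\Sigma_{\mathrm{CQR}}),\qquad \Sigma_{\mathrm{CQR}}=\mathbf C^{-1}\,\frac{\sum_{k,k'=1}^K\min(\tau_k,\tau_{k'})\bigl(1-\max(\tau_k,\tau_{k'})\bigr)}{\bigl(\sum_{k=1}^K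 f(b^*_{\tau_k})\bigr)^2},$$ where $\Sigma_{\mathrm{CQR}}$ is positive definite. -/

import Mathlib

open MeasureTheory ProbabilityTheory Filter Topology
open scoped Matrix

noncomputable section

/-- The check function `ρ_τ(t) = τ t₊ + (1 - τ) t₋`. -/
def checkFn (τ t : ℝ) : ℝ := τ * max t 0 + (1 - τ) * max (-t) 0

/-- The `100 τ %` quantile `inf {t | τ ≤ F t}` of a law on the real line with cdf `F`. -/
def quantile (μ : Measure ℝ) (τ : ℝ) : ℝ := sInf {t : ℝ | τ ≤ cdf μ t}

/-- The composite quantile regression objective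
`∑ₖ ∑ᵢ ρ_{τₖ}(yᵢ - bₖ - xᵢᵀ β)`; the rows of `X` are the `xᵢ`. -/
def cqrObjective {n p K : ℕ} (τ : Fin K → ℝ) (X : Matrix (Fin n) (Fin p) ℝ) (y : Fin n → ℝ)
    (b : Fin K → ℝ) (β : EuclideanSpace ℝ (Fin p)) : ℝ :=
  ∑ k, ∑ i, checkFn (τ k) (y i - b k - X i ⬝ᵥ β.ofLp)

/-- `(b, β)` is a global minimizer of the composite quantile regression objective. -/
def IsCQRMinimizer {n p K : ℕ} (τ : Fin K → ℝ) (X : Matrix (Fin n) (Fin p) ℝ) (y : Fin n → ℝ)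
    (b : Fin K → ℝ) (β : EuclideanSpace ℝ (Fin p)) : Prop :=
  ∀ (b' : Fin K → ℝ) (β' : EuclideanSpace ℝ (Fin p)),
    cqrObjective τ X y b β ≤ cqrObjective τ X y b' β'

/-- The response vector of the linear model with design matrix `X`, coefficients `β` and
errors `e`: `yᵢ = xᵢᵀ β + eᵢ`. -/
def linearResponse {n p : ℕ} (X : Matrix (Fin n) (Fin p) ℝ) (β : EuclideanSpace ℝ (Fin p))
    (e : Fin n → ℝ) : Fin n → ℝ :=
  fun i => X i ⬝ᵥ β.ofLp + e i

/-- The local-expansion condition on the cdf `F` and the density `f`: for all `a`, `u₀`, `u`,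
`(1/n) ∑ᵢ ∫₀^{u₀ + xᵢᵀ u} √n (F(a + t/√n) - F(a)) dt` tends to
`(1/2) f(a) (u₀, uᵀ) diag(1, C) (u₀, uᵀ)ᵀ`. -/
def LocalExpansion {p : ℕ} (X : (n : ℕ) → Matrix (Fin n) (Fin p) ℝ)
    (C : Matrix (Fin p) (Fin p) ℝ) (F f : ℝ → ℝ) : Prop :=
  ∀ (a u₀ : ℝ) (u : Fin p → ℝ),
    Tendsto
      (fun n : ℕ => (1 / (n : ℝ)) * ∑ i : Fin n,
        ∫ t in (0 : ℝ)..(u₀ + X n i ⬝ᵥ u), √(n : ℝ) * (F (a + t / √(n : ℝ)) - F a))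
      atTop
      (𝓝 (1 / 2 * f a * (u₀ ^ 2 + u ⬝ᵥ (C *ᵥ u))))

/-- The asymptotic covariance matrix
`C⁻¹ ∑_{k,k'} min(τₖ, τₖ') (1 - max(τₖ, τₖ')) / (∑ₖ f(b*_{τₖ}))²`, where `b*_τ` is the
`τ`-quantile of the error law `μ`. -/
def cqrCovariance {p K : ℕ} (τ : Fin K → ℝ) (C : Matrix (Fin p) (Fin p) ℝ) (μ : Measure ℝ)
    (f : ℝ → ℝ) : Matrix (Fin p) (Fin p) ℝ :=
  ((∑ k, ∑ l, min (τ k) (τ l) * (1 - max (τ k) (τ l))) /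
    (∑ k, f (quantile μ (τ k))) ^ 2) • C⁻¹

end

/-! Let b be the vector of true quantiles, and rescale intercept and slope deviations by √n.
Knight's identity (`checkFn_sub_eq`) splits the increment of the objective into a term linear in the
scores 1{ε ≤ b_k} - τ_k and a sum of nonnegative remainders. The mean of the remainder sum is
exactly the left side of the local-expansion condition (`integral_cdf_eq_meanKnightRem`), so it
converges to a quadratic form; its variance vanishes. Completing the square, the rescaled objective
is, up to a constant and an error tending to 0 in probability at each fixed point, a quadratic
around a random centre that is linear in the scores (`cqrScoreCenter`).

Convexity turns this pointwise statement into one about minimizers: closeness on a finite net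
suffices (`exists_finset_norm_minimizer_sub_lt`). Hence the rescaled estimation error differs from
the centre by a term tending to 0 in probability. The slope part of the centre is a weighted sum of
i.i.d. bounded centred variables; characteristic functions give its Gaussian limit, and Slutsky's
lemma transfers it to the estimator.

Both the variance bound and the central limit theorem need max_i |x_i^T u| / √n → 0, which is not
assumed. It is extracted from the local expansion (`eventually_forall_abs_le_of_tendsto_sum`): the
mean remainder is at most |w|, so a row that stays large contributes, after a large dilation, much
less than its quadratic share. Using many widely spaced dilations at once, the other rows cannot
make up the deficit. -/

/-! ### Minimizers of nearly quadratic convex functions -/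

/-- A bounded region of a finite-dimensional space admits a finite net such that every point of the
region is a convex combination of net points close to it. -/
theorem exists_finset_mem_convexHull_inter_closedBall {E : Type*} [NormedAddCommGroup E]
    [NormedSpace ℝ E] [FiniteDimensional ℝ E] (M : ℝ) {h : ℝ} (hh : 0 < h) :
    ∃ T : Finset E, ∀ x : E, ‖x‖ ≤ M → x ∈ convexHull ℝ (↑T ∩ Metric.closedBall x h) := by
  classical
  have key : ∀ x : E, ∃ S : Finset E, x ∈ interior (convexHull ℝ (S : Set E)) ∧
      convexHull ℝ (S : Set E) ⊆ Metric.ball x (h / 2) := by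
    intro x
    obtain ⟨b, hb1, hb2⟩ := exists_mem_interior_convexHull_affineBasis
      (Metric.ball_mem_nhds x (half_pos hh))
    refine ⟨Finset.univ.image b, ?_, ?_⟩ <;> simpa
  choose S hS1 hS2 using key
  have hK : IsCompact (Metric.closedBall (0 : E) M) := isCompact_closedBall 0 M
  obtain ⟨t, -, ht⟩ := hK.elim_nhds_subcover
    (fun x => interior (convexHull ℝ (S x : Set E)) ∩ Metric.ball x (h / 2))
    (fun x _ => Filter.inter_mem (isOpen_interior.mem_nhds (hS1 x))
      (Metric.ball_mem_nhds x (half_pos hh)))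
  refine ⟨t.biUnion S, fun x hx => ?_⟩
  have hx' := ht (mem_closedBall_zero_iff.2 hx)
  simp only [Set.mem_iUnion] at hx'
  obtain ⟨z, hz, hxz1, hxz2⟩ := hx'
  refine convexHull_mono ?_ (interior_subset hxz1)
  intro g hg
  refine ⟨?_, ?_⟩
  · simp only [Finset.coe_biUnion, Set.mem_iUnion]
    exact ⟨z, hz, hg⟩
  · have h1 := hS2 z (subset_convexHull ℝ _ hg)
    rw [Metric.mem_ball] at h1 hxz2
    rw [Metric.mem_closedBall]
    have := dist_triangle_right g x z
    linarith

/-- A convex function that is close, on a suitable finite set, to a translate of a function growing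
at least quadratically away from its zero has all its minimizers close to the translation point. -/
theorem exists_finset_norm_minimizer_sub_lt {E : Type*} [NormedAddCommGroup E]
    [NormedSpace ℝ E] [FiniteDimensional ℝ E] {q : E → ℝ} (hq : Continuous q) (hq0 : q 0 = 0)
    {c : ℝ} (hc : 0 < c) (hqc : ∀ v, c * ‖v‖ ^ 2 ≤ q v) (M : ℝ) {δ : ℝ} (hδ : 0 < δ) :
    ∃ T : Finset E, ∃ η > 0, ∀ (A : E → ℝ) (m s : E) (κ : ℝ), ConvexOn ℝ Set.univ A → ‖m‖ ≤ M →
      (∀ y, A s ≤ A y) → (∀ g ∈ T, |A g - (q (g - m) + κ)| ≤ η) → ‖s - m‖ < δ := by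
  have hcd : 0 < c * δ ^ 2 := by positivity
  obtain ⟨r, hr, hqr⟩ := Metric.continuous_iff.1 hq 0 (c * δ ^ 2 / 64) (by positivity)
  obtain ⟨h, hh, hhδ, hhr⟩ : ∃ h : ℝ, 0 < h ∧ h ≤ δ / 8 ∧ 3 * h < r :=
    ⟨min (δ / 8) (r / 4), by positivity, min_le_left _ _,
      by have := min_le_right (δ / 8) (r / 4); linarith⟩
  have hq3 : ∀ v : E, ‖v‖ ≤ 3 * h → q v ≤ c * δ ^ 2 / 64 := by
    intro v hv
    have := hqr v (by simpa using lt_of_le_of_lt hv hhr)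
    rw [hq0, Real.dist_eq, sub_zero] at this
    exact (le_abs_self _).trans this.le
  obtain ⟨T, hT⟩ := exists_finset_mem_convexHull_inter_closedBall (E := E) (M + δ) hh
  refine ⟨T, c * δ ^ 2 / 32, by positivity, fun A m s κ hA hm hs hAT => ?_⟩
  by_contra! hsm
  have hpos : 0 < ‖s - m‖ := hδ.trans_le hsm
  set θ : ℝ := δ / 2 / ‖s - m‖ with hθ
  have hθ0 : 0 < θ := by positivity
  have hθ1 : θ ≤ 1 / 2 := by
    rw [hθ, div_le_iff₀ hpos]; linarith
  have hθn : θ * ‖s - m‖ = δ / 2 := by rw [hθ]; field_simp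
  -- The point of the segment from `m` to `s` at distance `δ / 2` from `m`.
  set y : E := m + θ • (s - m) with hy
  have hym : ‖y - m‖ = δ / 2 := by
    rw [hy, add_sub_cancel_left, norm_smul, Real.norm_of_nonneg hθ0.le, hθn]
  have hyM : ‖y‖ ≤ M + δ := by
    have := norm_add_le (y - m) m
    rw [sub_add_cancel] at this
    linarith
  obtain ⟨g, hgT, hgy⟩ := convexHull_nonempty_iff.1 ⟨y, hT y hyM⟩
  rw [Metric.mem_closedBall, dist_eq_norm] at hgy
  -- The net point `g` near `y` is off the segment, so the endpoint `m` is shifted by at most `2 *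
  -- h` to put `g` exactly between `m'` and `s`. As `s` minimizes `A`, convexity then gives `A g ≤ A
  -- m'`.
  set m' : E := m + (1 - θ)⁻¹ • (g - y) with hm'
  have h1θ : 0 < 1 - θ := by linarith
  have hm'm : ‖m' - m‖ ≤ 2 * h := by
    rw [hm', add_sub_cancel_left, norm_smul, Real.norm_of_nonneg (by positivity)]
    have : (1 - θ)⁻¹ ≤ 2 := by
      rw [inv_le_comm₀ h1θ two_pos]; linarith
    exact mul_le_mul this hgy (norm_nonneg _) two_pos.le
  have hm'M : ‖m'‖ ≤ M + δ := by
    have := norm_add_le (m' - m) m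
    rw [sub_add_cancel] at this
    linarith
  have hgcomb : g = (1 - θ) • m' + θ • s := by
    rw [hm', smul_add, smul_smul, mul_inv_cancel₀ h1θ.ne', hy]
    module
  have hAg : A g ≤ A m' := by
    have := hA.2 (Set.mem_univ m') (Set.mem_univ s) h1θ.le hθ0.le (by ring)
    rw [← hgcomb, smul_eq_mul, smul_eq_mul] at this
    have h2 := hs m'
    nlinarith
  -- `m'` need not be a net point, but a convex function on a hull is dominated by its value at some
  -- generating point.
  obtain ⟨g', ⟨hg'T, hg'm⟩, hAg'⟩ :=
    (hA.subset (Set.subset_univ _) (convex_convexHull ℝ _)).exists_ge_of_mem_convexHull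
      (subset_convexHull ℝ _) (hT m' hm'M)
  rw [Metric.mem_closedBall, dist_eq_norm] at hg'm
  have hg'q : q (g' - m) ≤ c * δ ^ 2 / 64 := by
    apply hq3
    have := norm_add_le (g' - m') (m' - m)
    rw [sub_add_sub_cancel] at this
    linarith
  have hgq : c * (9 * δ ^ 2 / 64) ≤ q (g - m) := by
    refine le_trans ?_ (hqc _)
    have : 3 * δ / 8 ≤ ‖g - m‖ := by
      have := norm_sub_le (g - m) (g - y)
      rw [sub_sub_sub_cancel_left, hym] at this
      linarith
    refine mul_le_mul_of_nonneg_left ?_ hc.le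
    nlinarith
  -- `A g ≤ A g'`, yet `q` differs at the two points by at least `(9 - 1) / 64 * c * δ ^ 2`, twice
  -- the tolerance `2 * η`.
  have e1 := abs_le.1 (hAT g hgT)
  have e2 := abs_le.1 (hAT g' hg'T)
  linarith [e1.1, e2.2]

/-! ### Uniform negligibility of rows -/

/-- Widely spaced dilations of a function of at most quadratic behaviour near `0` and at most linear
growth: on average the rescaled dilations are at most quadratic, with the constant at `0`. -/
theorem exists_dilations_sum_le {D : ℝ → ℝ} {c : ℝ} (hlin : ∀ w, D w ≤ |w|)
    (hquad : ∀ e > 0, ∃ r > 0, ∀ w, |w| ≤ r → D w ≤ (c + e) * w ^ 2) {e : ℝ} (he : 0 < e)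
    (hc : 0 < c) (L : ℝ) :
    ∃ B : ℝ, ∀ J : ℕ, ∃ lam : Fin J → ℝ, (∀ j, L ≤ lam j ∧ 0 < lam j) ∧
      ∀ v, ∑ j, D (lam j * v) / lam j ^ 2 ≤ (J * (c + e) + B) * v ^ 2 := by
  obtain ⟨r, hr, hDr⟩ := hquad e he
  have hM : ∀ w, D w ≤ (c + e + 1 / r) * w ^ 2 := by
    intro w
    rcases le_total |w| r with h | h
    · have := hDr w h
      have : 0 ≤ 1 / r * w ^ 2 := by positivity
      linarith
    · have h1 : |w| ≤ 1 / r * w ^ 2 := by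
        rw [← sq_abs w, div_mul_eq_mul_div, le_div_iff₀ hr]
        nlinarith [abs_nonneg w]
      have : 0 ≤ (c + e) * w ^ 2 := by positivity
      linarith [hlin w]
  -- The last clause drives the induction: near 0 there is no excess `1 / r`. A new dilation is
  -- taken so large that it has no excess beyond that range, so at each `v` the excess is paid at
  -- most once and the constant does not grow with `J`.
  have key : ∀ J : ℕ, ∃ lam : Fin J → ℝ, (∀ j, L ≤ lam j ∧ 0 < lam j) ∧
      (∀ v, ∑ j, D (lam j * v) / lam j ^ 2 ≤ (J * (c + e) + 1 / r) * v ^ 2) ∧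
      ∃ ρ > 0, ∀ v, |v| ≤ ρ → ∑ j, D (lam j * v) / lam j ^ 2 ≤ J * (c + e) * v ^ 2 := by
    intro J
    induction J with
    | zero =>
      refine ⟨Fin.elim0, fun j => j.elim0, fun v => ?_, 1, one_pos, fun v _ => by simp⟩
      simp only [Finset.univ_eq_empty, Finset.sum_empty]
      positivity
    | succ J ih =>
      obtain ⟨lam, h1, h2, ρ, hρ, h3⟩ := ih
      obtain ⟨l, hlL, hl0, hlρ⟩ : ∃ l : ℝ, L ≤ l ∧ 0 < l ∧ 1 / (c + e) ≤ l * ρ := by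
        refine ⟨max L (max 1 (1 / (c + e) / ρ)), le_max_left _ _,
          lt_of_lt_of_le one_pos ((le_max_left _ _).trans (le_max_right _ _)), ?_⟩
        rw [← div_le_iff₀ hρ]
        exact (le_max_right _ _).trans (le_max_right _ _)
      refine ⟨Fin.cons l lam, Fin.cases ⟨hlL, hl0⟩ h1, fun v => ?_, min ρ (r / l), by positivity,
        fun v hv => ?_⟩
      · simp only [Fin.sum_univ_succ, Fin.cons_zero, Fin.cons_succ]
        push_cast
        rcases le_total |v| ρ with hv | hv
        · have e1 : D (l * v) / l ^ 2 ≤ (c + e + 1 / r) * v ^ 2 := by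
            rw [div_le_iff₀ (by positivity)]
            have := hM (l * v)
            linarith
          have e2 := h3 v hv
          linarith
        -- Here the linear bound alone suffices: the quotient is at most `|v| / l`, and `l * |v| ≥ 1
        -- / (c + e)`.
        · have e1 : D (l * v) / l ^ 2 ≤ (c + e) * v ^ 2 := by
            rw [div_le_iff₀ (by positivity)]
            refine (hlin _).trans ?_
            rw [abs_mul, abs_of_pos hl0, ← sq_abs v]
            have e3 : 1 ≤ (c + e) * (l * |v|) := by
              rw [div_le_iff₀ (by positivity)] at hlρ
              have : l * ρ ≤ l * |v| := by gcongr
              nlinarith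
            have e4 : 0 ≤ l * |v| := by positivity
            nlinarith
          have e2 := h2 v
          linarith
      · simp only [Fin.sum_univ_succ, Fin.cons_zero, Fin.cons_succ]
        push_cast
        have e1 : D (l * v) / l ^ 2 ≤ (c + e) * v ^ 2 := by
          rw [div_le_iff₀ (by positivity)]
          have := hDr (l * v) (by
            rw [abs_mul, abs_of_pos hl0, mul_comm, ← le_div_iff₀ hl0]
            exact hv.trans (min_le_right _ _))
          linarith
        have e2 := h3 v (hv.trans (min_le_left _ _))
        linarith
  exact ⟨1 / r, fun J => let ⟨lam, h1, h2, _⟩ := key J; ⟨lam, h1, h2⟩⟩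

/-- If row sums of all dilations of a function with quadratic constant `c` at `0` and linear
growth behave as for the function `c * w ^ 2`, then the rows are uniformly negligible. -/
theorem eventually_forall_abs_le_of_tendsto_sum {D : ℝ → ℝ} {c σ : ℝ} (hc : 0 < c)
    (hlin : ∀ w, D w ≤ |w|)
    (hquad : ∀ e > 0, ∃ r > 0, ∀ w, |w| ≤ r → D w ≤ (c + e) * w ^ 2)
    {v : (n : ℕ) → Fin n → ℝ} (hv : Tendsto (fun n => ∑ i, v n i ^ 2) atTop (𝓝 σ))
    (hD : ∀ l : ℝ, Tendsto (fun n => ∑ i, D (l * v n i)) atTop (𝓝 (c * (l ^ 2 * σ))))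
    {δ : ℝ} (hδ : 0 < δ) : ∀ᶠ n in atTop, ∀ i, |v n i| ≤ δ := by
  have hσ : 0 ≤ σ := ge_of_tendsto' hv fun n => Finset.sum_nonneg fun i _ => sq_nonneg _
  obtain ⟨e, he, heσ⟩ : ∃ e : ℝ, 0 < e ∧ e * (σ + 1) ≤ c * δ ^ 2 / 8 :=
    ⟨c * δ ^ 2 / 8 / (σ + 1), by positivity, by rw [div_mul_cancel₀ _ (by positivity)]⟩
  obtain ⟨B, hB⟩ := exists_dilations_sum_le hlin hquad he hc (2 / (c * δ))
  -- A large row costs a deficit proportional to `J`, whereas the excess `|B| * (σ + 1)` is fixed.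
  obtain ⟨J, hJ⟩ := exists_nat_gt (max 1 (|B| * (σ + 1) / (c * δ ^ 2 / 8)))
  have hJ1 : (1 : ℝ) < J := (le_max_left _ _).trans_lt hJ
  have hJB : |B| * (σ + 1) < J * (c * δ ^ 2 / 8) := by
    rw [← div_lt_iff₀ (by positivity)]
    exact (le_max_right _ _).trans_lt hJ
  obtain ⟨lam, hlam, hsum⟩ := hB J
  have hlim : Tendsto (fun n => ∑ j, (∑ i, D (lam j * v n i)) / lam j ^ 2) atTop
      (𝓝 (J * (c * σ))) := by
    have : (J * (c * σ) : ℝ) = ∑ j : Fin J, c * (lam j ^ 2 * σ) / lam j ^ 2 := by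
      rw [Finset.sum_congr rfl (g := fun _ => c * σ)]
      · simp
      · intro j _
        have := (hlam j).2.ne'
        field_simp
    rw [this]
    exact tendsto_finsetSum _ fun j _ => (hD (lam j)).div_const _
  have hgap : 0 < c * δ ^ 2 / 16 := by positivity
  have hgap' : 0 < min 1 (c * δ ^ 2 / 16 / (c + e)) := by positivity
  filter_upwards [hlim.eventually (lt_mem_nhds (show J * (c * σ) - c * δ ^ 2 / 16 < J * (c * σ) by
    linarith)), hv.eventually (gt_mem_nhds (show σ < σ + min 1 (c * δ ^ 2 / 16 / (c + e)) by
    linarith))] with n hn1 hn2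
  by_contra! hcon
  obtain ⟨i0, hi0⟩ := hcon
  -- Every dilation is at least `2 / (c * δ)`, so the linear bound gives the large row at most half
  -- of its quadratic share.
  have hbig : ∑ j, D (lam j * v n i0) / lam j ^ 2 ≤ J * (c / 2) * v n i0 ^ 2 := by
    have : ∀ j ∈ Finset.univ, D (lam j * v n i0) / lam j ^ 2 ≤ c / 2 * v n i0 ^ 2 := by
      intro j _
      obtain ⟨hL, hl0⟩ := hlam j
      rw [div_le_iff₀ (by positivity)]
      refine (hlin _).trans ?_
      rw [abs_mul, abs_of_pos hl0, ← sq_abs (v n i0)]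
      rw [div_le_iff₀ (by positivity)] at hL
      have h1 : 1 ≤ c / 2 * (lam j * |v n i0|) := by
        have : lam j * (c * δ) ≤ lam j * (c * |v n i0|) := by gcongr
        linarith
      have e4 : 0 ≤ lam j * |v n i0| := by positivity
      nlinarith
    refine (Finset.sum_le_sum this).trans (le_of_eq ?_)
    simp; ring
  have hswap : ∑ j, (∑ i, D (lam j * v n i)) / lam j ^ 2
      = ∑ i, ∑ j, D (lam j * v n i) / lam j ^ 2 := by
    simp_rw [Finset.sum_div]
    exact Finset.sum_comm
  have hrest : ∑ i ∈ Finset.univ.erase i0, ∑ j, D (lam j * v n i) / lam j ^ 2 ≤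
      (J * (c + e) + |B|) * ∑ i ∈ Finset.univ.erase i0, v n i ^ 2 := by
    rw [Finset.mul_sum]
    refine Finset.sum_le_sum fun i _ => (hsum (v n i)).trans ?_
    gcongr
    exact le_abs_self B
  have hsplit1 := Finset.sum_erase_add Finset.univ
    (fun i => ∑ j, D (lam j * v n i) / lam j ^ 2) (Finset.mem_univ i0)
  have hsplit2 := Finset.sum_erase_add Finset.univ (fun i => v n i ^ 2) (Finset.mem_univ i0)
  have hv0 : δ ^ 2 ≤ v n i0 ^ 2 := by
    rw [← sq_abs (v n i0)]; gcongr
  rw [hswap] at hn1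
  set S := ∑ i, v n i ^ 2
  set S' := ∑ i ∈ Finset.univ.erase i0, v n i ^ 2
  have hS1 : S ≤ σ + 1 := hn2.le.trans (by gcongr; exact min_le_left _ _)
  have hS2 : (c + e) * (S - σ) ≤ c * δ ^ 2 / 16 := by
    have : S - σ ≤ c * δ ^ 2 / 16 / (c + e) := by
      have := min_le_right 1 (c * δ ^ 2 / 16 / (c + e)); linarith
    rwa [le_div_iff₀ (by positivity), mul_comm] at this
  have hS'0 : 0 ≤ S' := Finset.sum_nonneg fun i _ => sq_nonneg _
  have hS'S : S' = S - v n i0 ^ 2 := by linarith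
  have t1 : |B| * S' ≤ |B| * (σ + 1) := by gcongr; nlinarith
  have t2 : J * (c * σ) - c * δ ^ 2 / 16 <
      (J * (c + e) + |B|) * S' + J * (c / 2) * v n i0 ^ 2 := by linarith
  have t3 : (J * (c + e)) * S' + J * (c / 2) * v n i0 ^ 2 ≤
      J * ((c + e) * S - c / 2 * δ ^ 2) := by
    rw [hS'S]
    have : (J : ℝ) * ((c / 2 + e) * v n i0 ^ 2) ≥ J * (c / 2 * δ ^ 2) := by
      gcongr; linarith
    nlinarith
  have t4 : (c + e) * S - c / 2 * δ ^ 2 ≤ c * σ - c * δ ^ 2 / 4 := by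
    nlinarith
  have t5 : (J : ℝ) * ((c + e) * S - c / 2 * δ ^ 2) ≤ J * (c * σ - c * δ ^ 2 / 4) := by gcongr
  have t6 : c * δ ^ 2 / 16 ≤ J * (c * δ ^ 2 / 16) := by nlinarith
  have t7 : (0 : ℝ) < J * (c * δ ^ 2 / 16) := by positivity
  linarith [t1, t2, t3, t5, hJB]

/-! ### Knight's identity and its remainder -/

/-- The remainder `∫₀ˢ (1{r ≤ t} - 1{r ≤ 0}) dt` in the first-order expansion of the check function
(Knight's identity). -/
noncomputable def knightRem (r s : ℝ) : ℝ :=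
  max (s - r) 0 - max (-r) 0 - s * (if r ≤ 0 then 1 else 0)

/-- **Knight's identity.** -/
theorem checkFn_sub_eq (τ r s : ℝ) :
    checkFn τ (r - s) = checkFn τ r + s * ((if r ≤ 0 then 1 else 0) - τ) + knightRem r s := by
  have h : ∀ t : ℝ, checkFn τ t = τ * t + max (-t) 0 := by
    intro t
    unfold checkFn
    rcases le_total t 0 with ht | ht
    · rw [max_eq_right ht, max_eq_left (by linarith)]; ring
    · rw [max_eq_left ht, max_eq_right (by linarith)]; ring
  rw [h, h, knightRem, neg_sub]
  ring

theorem checkFn_convexOn {τ : ℝ} (hτ : τ ∈ Set.Ioo (0 : ℝ) 1) :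
    ConvexOn ℝ Set.univ (checkFn τ) := by
  have h1 : ConvexOn ℝ Set.univ (fun t : ℝ => max t 0) :=
    (convexOn_id convex_univ).sup (convexOn_const 0 convex_univ)
  have h2 : ConvexOn ℝ Set.univ (fun t : ℝ => max (-t) 0) :=
    (LinearMap.convexOn (-LinearMap.id : ℝ →ₗ[ℝ] ℝ) convex_univ).sup
      (convexOn_const 0 convex_univ)
  exact (h1.smul hτ.1.le).add (h2.smul (sub_nonneg.2 hτ.2.le))

theorem knightRem_nonneg (r s : ℝ) : 0 ≤ knightRem r s := by
  unfold knightRem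
  split_ifs with h
  · rw [max_eq_left (by linarith : 0 ≤ -r)]
    linarith [le_max_left (s - r) 0]
  · rw [max_eq_right (by linarith : -r ≤ 0)]
    linarith [le_max_right (s - r) 0]

theorem knightRem_le_abs (r s : ℝ) : knightRem r s ≤ |s| := by
  unfold knightRem
  split_ifs with h
  · rw [max_eq_left (by linarith : 0 ≤ -r)]
    rcases le_total (s - r) 0 with h1 | h1
    · rw [max_eq_right h1]; linarith [neg_le_abs s]
    · rw [max_eq_left h1]; linarith [abs_nonneg s]
  · rw [max_eq_right (by linarith : -r ≤ 0)]
    have : max (s - r) 0 ≤ |s| := max_le (by linarith [le_abs_self s]) (abs_nonneg s)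
    linarith

/-- Together with its mirror image, this lets the values of the mean remainder at ±1/√n control all
small arguments. -/
theorem knightRem_mono_right (r : ℝ) {s s' : ℝ} (hs : 0 ≤ s) (h : s ≤ s') :
    knightRem r s ≤ knightRem r s' := by
  unfold knightRem
  split_ifs with hr
  · rw [max_eq_left (by linarith : 0 ≤ s - r), max_eq_left (by linarith : 0 ≤ s' - r)]
    linarith
  · have : max (s - r) 0 ≤ max (s' - r) 0 := by gcongr
    linarith

theorem knightRem_anti_right (r : ℝ) {s s' : ℝ} (hs : s ≤ 0) (h : s' ≤ s) :
    knightRem r s ≤ knightRem r s' := by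
  unfold knightRem
  split_ifs with hr
  · rcases le_total (s - r) 0 with h1 | h1
    · rw [max_eq_right h1, max_eq_right (by linarith : s' - r ≤ 0)]
      linarith
    · rw [max_eq_left h1]
      linarith [le_max_left (s' - r) 0]
  · rw [max_eq_right (by linarith : s - r ≤ 0), max_eq_right (by linarith : s' - r ≤ 0)]
    linarith

@[fun_prop]
theorem measurable_knightRem (s : ℝ) : Measurable (fun r => knightRem r s) := by
  unfold knightRem
  refine (Measurable.sub (by fun_prop) (by fun_prop)).sub (measurable_const.mul ?_)
  exact Measurable.ite measurableSet_Iic measurable_const measurable_const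

theorem intervalIntegrable_ite_le (r a b : ℝ) :
    IntervalIntegrable (fun t : ℝ => if r ≤ t then (1 : ℝ) else 0) volume a b := by
  refine Monotone.intervalIntegrable fun x y hxy => ?_
  split_ifs with h1 h2 <;> linarith

/-- The positive part of t - r has right derivative 1{r ≤ t} everywhere, including at the kink, so
the fundamental theorem for right derivatives applies. -/
theorem knightRem_eq_integral (r s : ℝ) :
    knightRem r s =
      ∫ t in (0 : ℝ)..s, ((if r ≤ t then (1 : ℝ) else 0) - (if r ≤ 0 then 1 else 0)) := by
  have h : ∫ t in (0 : ℝ)..s, (if r ≤ t then (1 : ℝ) else 0) = max (s - r) 0 - max (0 - r) 0 := by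
    refine intervalIntegral.integral_eq_sub_of_hasDeriv_right (f := fun t => max (t - r) 0)
      (by fun_prop) (fun t _ => ?_) (intervalIntegrable_ite_le _ _ _)
    split_ifs with h
    · refine ((hasDerivAt_id t).sub_const r).hasDerivWithinAt.congr (fun y hy => ?_) ?_
      · simp only [id]; rw [max_eq_left]; have := Set.mem_Ioi.1 hy; linarith
      · simp only [id]; rw [max_eq_left]; linarith
    · refine HasDerivAt.hasDerivWithinAt ?_
      refine (hasDerivAt_const t (0 : ℝ)).congr_of_eventuallyEq ?_
      filter_upwards [gt_mem_nhds (not_le.1 h)] with y hy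
      rw [max_eq_right]; linarith
  rw [intervalIntegral.integral_sub (intervalIntegrable_ite_le _ _ _) (by simp), h]
  simp [knightRem]

/-! ### Mean of the Knight remainder -/

/-- The expectation of the Knight remainder under the law `μ` centred at `a`. -/
noncomputable def meanKnightRem (μ : Measure ℝ) (a s : ℝ) : ℝ := ∫ x, knightRem (x - a) s ∂μ

section Mean
variable (μ : Measure ℝ) [IsProbabilityMeasure μ]

theorem integrable_knightRem (a s : ℝ) : Integrable (fun x => knightRem (x - a) s) μ := by
  refine Integrable.of_bound (C := |s|) ?_ (ae_of_all _ fun x => ?_)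
  · exact ((measurable_knightRem s).comp (measurable_id.sub_const a)).aestronglyMeasurable
  · rw [Real.norm_of_nonneg (knightRem_nonneg _ _)]
    exact knightRem_le_abs _ _

theorem meanKnightRem_le_abs (a s : ℝ) : meanKnightRem μ a s ≤ |s| := by
  refine (integral_mono (integrable_knightRem μ a s) (integrable_const |s|)
    fun x => knightRem_le_abs _ _).trans (le_of_eq (by simp))

theorem meanKnightRem_mono_right (a : ℝ) {s s' : ℝ} (hs : 0 ≤ s) (h : s ≤ s') :
    meanKnightRem μ a s ≤ meanKnightRem μ a s' :=
  integral_mono (integrable_knightRem μ a s) (integrable_knightRem μ a s')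
    fun _ => knightRem_mono_right _ hs h

theorem meanKnightRem_anti_right (a : ℝ) {s s' : ℝ} (hs : s ≤ 0) (h : s' ≤ s) :
    meanKnightRem μ a s ≤ meanKnightRem μ a s' :=
  integral_mono (integrable_knightRem μ a s) (integrable_knightRem μ a s')
    fun _ => knightRem_anti_right _ hs h

/-- Since 0 ≤ R ≤ |s|, one has R² ≤ |s| R. Summed over rows, the variance is at most the largest |s|
times a convergent sum of means. -/
theorem integral_sq_knightRem_le (a s : ℝ) :
    ∫ x, knightRem (x - a) s ^ 2 ∂μ ≤ |s| * meanKnightRem μ a s := by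
  rw [meanKnightRem, ← integral_const_mul]
  refine integral_mono_of_nonneg (ae_of_all _ fun x => sq_nonneg _)
    ((integrable_knightRem μ a s).const_mul _) (ae_of_all _ fun x => ?_)
  dsimp only
  rw [sq]
  exact mul_le_mul_of_nonneg_right (knightRem_le_abs _ _) (knightRem_nonneg _ _)

theorem integral_ite_le_eq_cdf (b : ℝ) : ∫ x, (if x ≤ b then (1 : ℝ) else 0) ∂μ = cdf μ b := by
  rw [cdf_eq_real, ← integral_indicator_one measurableSet_Iic]
  rfl

theorem integrable_ite_le (b : ℝ) : Integrable (fun x : ℝ => if x ≤ b then (1 : ℝ) else 0) μ :=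
  (integrable_indicator_iff measurableSet_Iic).2 (integrableOn_const (μ := μ) (C := (1 : ℝ)))

/-- Fubini applied to the integral form of the remainder; the expected indicators are values of the
cdf. -/
theorem meanKnightRem_eq_integral (a s : ℝ) :
    meanKnightRem μ a s = ∫ t in (0 : ℝ)..s, (cdf μ (a + t) - cdf μ a) := by
  have hmeas : Measurable (Function.uncurry fun (t x : ℝ) =>
      (if x - a ≤ t then (1 : ℝ) else 0) - (if x - a ≤ 0 then 1 else 0)) := by
    refine Measurable.sub ?_ ?_ <;>
    exact Measurable.ite (measurableSet_le (by fun_prop) (by fun_prop)) measurable_const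
      measurable_const
  have hint : Integrable (Function.uncurry fun (t x : ℝ) =>
      (if x - a ≤ t then (1 : ℝ) else 0) - (if x - a ≤ 0 then 1 else 0))
      ((volume.restrict (Set.uIoc 0 s)).prod μ) := by
    have : IsFiniteMeasure (volume.restrict (Set.uIoc 0 s)) :=
      isFiniteMeasure_restrict.2 (by simp [Set.uIoc])
    refine Integrable.of_bound (C := 1) hmeas.aestronglyMeasurable (ae_of_all _ fun z => ?_)
    simp only [Function.uncurry]
    split_ifs <;> norm_num
  have hin : ∀ t : ℝ, ∫ x, ((if x - a ≤ t then (1 : ℝ) else 0) - (if x - a ≤ 0 then 1 else 0)) ∂μ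
      = cdf μ (a + t) - cdf μ a := by
    intro t
    have h1 : ∀ x t : ℝ, (x - a ≤ t) = (x ≤ a + t) := fun x t => by
      rw [sub_le_iff_le_add, add_comm]
    simp only [h1]
    rw [integral_sub (integrable_ite_le μ _) (integrable_ite_le μ _),
      integral_ite_le_eq_cdf, integral_ite_le_eq_cdf, add_zero]
  simp only [meanKnightRem, knightRem_eq_integral]
  rw [← intervalIntegral_integral_swap hint]
  simp only [hin]

/-- The summands of the local-expansion condition are expected Knight remainders. -/
theorem integral_cdf_eq_meanKnightRem (a w : ℝ) {n : ℕ} (hn : 0 < n) :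
    (1 / (n : ℝ)) * ∫ t in (0 : ℝ)..w, √(n : ℝ) * (cdf μ (a + t / √(n : ℝ)) - cdf μ a) =
      meanKnightRem μ a (w / √(n : ℝ)) := by
  have hn' : (0 : ℝ) < n := by exact_mod_cast hn
  have hs : 0 < √(n : ℝ) := Real.sqrt_pos.2 hn'
  rw [meanKnightRem_eq_integral, intervalIntegral.integral_const_mul,
    intervalIntegral.integral_comp_div (fun t => cdf μ (a + t) - cdf μ a) hs.ne', smul_eq_mul,
    zero_div]
  rw [← mul_assoc, ← mul_assoc, mul_assoc (1 / (n : ℝ)), Real.mul_self_sqrt hn'.le,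
    one_div_mul_cancel hn'.ne', one_mul]
end Mean

/-- A function monotone in each direction away from `0` whose values at `± 1 / √n` are
asymptotically `c / n` is at most `(c + e) * w ^ 2` near `0`. -/
theorem exists_forall_abs_le_of_tendsto_mul {D : ℝ → ℝ} {c : ℝ} (hc : 0 < c)
    (hmono : ∀ s s', 0 ≤ s → s ≤ s' → D s ≤ D s') (hanti : ∀ s s', s ≤ 0 → s' ≤ s → D s ≤ D s')
    (hpos : Tendsto (fun n : ℕ => n * D (1 / √(n : ℝ))) atTop (𝓝 c))
    (hneg : Tendsto (fun n : ℕ => n * D (-1 / √(n : ℝ))) atTop (𝓝 c))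
    (h0 : D 0 = 0) {e : ℝ} (he : 0 < e) :
    ∃ r > 0, ∀ w, |w| ≤ r → D w ≤ (c + e) * w ^ 2 := by
  have hfac : Tendsto (fun n : ℕ => (c + e / 2) * (1 + 1 / (n : ℝ))) atTop
      (𝓝 ((c + e / 2) * (1 + 0))) :=
    (tendsto_one_div_atTop_nhds_zero_nat.const_add 1).const_mul _
  have hev := ((hpos.eventually (gt_mem_nhds (show c < c + e / 2 by linarith))).and
    (hneg.eventually (gt_mem_nhds (show c < c + e / 2 by linarith)))).and
    (hfac.eventually (gt_mem_nhds (show (c + e / 2) * (1 + 0) < c + e by linarith)))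
  obtain ⟨N, hN⟩ := eventually_atTop.1 hev
  refine ⟨1 / √((N : ℝ) + 1), by positivity, fun w hw => ?_⟩
  rcases eq_or_ne w 0 with rfl | hw0
  · simp [h0]
  have hw2 : 0 < w ^ 2 := by positivity
  have hwN : w ^ 2 ≤ 1 / ((N : ℝ) + 1) := by
    rw [← sq_abs w]
    calc |w| ^ 2 ≤ (1 / √((N : ℝ) + 1)) ^ 2 := by gcongr
      _ = 1 / ((N : ℝ) + 1) := by rw [div_pow, one_pow, Real.sq_sqrt (by positivity)]
  -- This choice puts `|w|` just below `1 / √n`: monotonicity bounds `D w` by the value there, and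
  -- `1 < (n + 1) * w ^ 2` converts `1 / n` back into `w ^ 2`.
  set n := ⌊1 / w ^ 2⌋₊ with hn
  have hnle : (n : ℝ) ≤ 1 / w ^ 2 := Nat.floor_le (by positivity)
  have hnlt : 1 / w ^ 2 < n + 1 := Nat.lt_floor_add_one _
  have hNn : N + 1 ≤ n := by
    refine Nat.le_floor ?_
    rw [le_div_iff₀ hw2]
    rw [le_div_iff₀ (by positivity)] at hwN
    push_cast; linarith
  have hn0 : (0 : ℝ) < n := by exact_mod_cast (by omega : 0 < n)
  have hws : |w| ≤ 1 / √(n : ℝ) := by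
    rw [le_div_iff₀ (by positivity)]
    refine le_of_sq_le_sq ?_ (by norm_num)
    rw [mul_pow, sq_abs, Real.sq_sqrt hn0.le, one_pow]
    rw [le_div_iff₀ hw2] at hnle
    linarith
  obtain ⟨⟨h1, h2⟩, h3⟩ := hN n (by omega)
  have hmain : n * D w ≤ c + e / 2 := by
    rcases le_total 0 w with hw' | hw'
    · have := hmono w _ hw' ((le_abs_self w).trans hws)
      exact (mul_le_mul_of_nonneg_left this hn0.le).trans h1.le
    · have := hanti w (-1 / √(n : ℝ)) hw' (by rw [neg_div]; linarith [neg_le_abs w])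
      exact (mul_le_mul_of_nonneg_left this hn0.le).trans h2.le
  rw [div_lt_iff₀ hw2] at hnlt
  calc D w = n * D w / n := by field_simp
    _ ≤ (c + e / 2) / n := by gcongr
    _ ≤ (c + e / 2) / n * ((n + 1) * w ^ 2) := le_mul_of_one_le_right (by positivity) hnlt.le
    _ = (c + e / 2) * (1 + 1 / n) * w ^ 2 := by field_simp
    _ ≤ (c + e) * w ^ 2 := by gcongr

/-! ### Central limit theorem and Chebyshev bound for weighted sums -/

/-- Telescoping: the factors are exchanged one at a time, and all the others lie in the unit disc.
-/
theorem norm_prod_sub_prod_le_sum {ι : Type*} (s : Finset ι) (a b : ι → ℂ)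
    (ha : ∀ i, ‖a i‖ ≤ 1) (hb : ∀ i, ‖b i‖ ≤ 1) :
    ‖∏ i ∈ s, a i - ∏ i ∈ s, b i‖ ≤ ∑ i ∈ s, ‖a i - b i‖ := by
  classical
  induction s using Finset.induction_on with
  | empty => simp
  | insert i s hi ih =>
    rw [Finset.prod_insert hi, Finset.prod_insert hi, Finset.sum_insert hi]
    have hbs : ‖∏ j ∈ s, b j‖ ≤ 1 := by
      rw [norm_prod]; exact Finset.prod_le_one (fun _ _ => norm_nonneg _) fun j _ => hb j
    calc ‖a i * ∏ j ∈ s, a j - b i * ∏ j ∈ s, b j‖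
        = ‖a i * (∏ j ∈ s, a j - ∏ j ∈ s, b j) + (a i - b i) * ∏ j ∈ s, b j‖ := by ring_nf
      _ ≤ ‖a i‖ * ‖∏ j ∈ s, a j - ∏ j ∈ s, b j‖ + ‖a i - b i‖ * ‖∏ j ∈ s, b j‖ := by
        refine (norm_add_le _ _).trans ?_
        rw [norm_mul, norm_mul]
      _ ≤ 1 * ‖∏ j ∈ s, a j - ∏ j ∈ s, b j‖ + ‖a i - b i‖ * 1 := by gcongr; exact ha i
      _ ≤ _ := by rw [one_mul, mul_one]; linarith

/-- Row products of a function with the second-order expansion of a centred Gaussian characteristic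
function, along uniformly negligible rows. -/
theorem tendsto_prod_of_isLittleO {φ : ℝ → ℂ} {s σ : ℝ} (hs : 0 ≤ s) (hφ1 : ∀ t, ‖φ t‖ ≤ 1)
    (hφ : (fun t : ℝ => φ t - (1 - s * t ^ 2 / 2 : ℝ)) =o[𝓝 0] fun t => t ^ 2)
    {v : (n : ℕ) → Fin n → ℝ} (hv : Tendsto (fun n => ∑ i, v n i ^ 2) atTop (𝓝 σ))
    (hmax : ∀ δ > 0, ∀ᶠ n in atTop, ∀ i, |v n i| ≤ δ) :
    Tendsto (fun n => ∏ i, φ (v n i)) atTop (𝓝 (Real.exp (-(s * σ / 2)) : ℝ)) := by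
  have hexp : (fun t : ℝ => ((Real.exp (-(s * t ^ 2 / 2)) : ℝ) : ℂ) - (1 - s * t ^ 2 / 2 : ℝ))
      =o[𝓝 0] fun t => t ^ 2 := by
    have h1 : (fun x : ℝ => Real.exp x - 1 - x) =o[𝓝 0] fun x => x := by
      have := (hasDerivAt_iff_isLittleO.1 (Real.hasDerivAt_exp 0))
      simpa using this
    have h2 : Tendsto (fun t : ℝ => -(s * t ^ 2 / 2)) (𝓝 0) (𝓝 0) := by
      have : Continuous fun t : ℝ => -(s * t ^ 2 / 2) := by fun_prop
      simpa using this.tendsto 0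
    have h3 := (h1.comp_tendsto h2).trans_isBigO
      (Asymptotics.isBigO_of_le' (c := s / 2) (g := fun t : ℝ => t ^ 2) (𝓝 0) fun t => by
        simp only [Function.comp, norm_neg, norm_div, norm_mul, norm_pow, Real.norm_eq_abs,
          abs_of_nonneg hs, Nat.abs_ofNat]
        exact le_of_eq (by ring))
    refine Asymptotics.IsLittleO.of_norm_left (h3.norm_left.congr_left fun t => ?_)
    rw [← Complex.ofReal_sub, Complex.norm_real]
    simp only [Function.comp]
    congr 1; ring
  have hdiff := hφ.sub hexp
  simp only [sub_sub_sub_cancel_right] at hdiff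
  -- For Gaussian factors the row product depends only on the sum of squares, so its limit is
  -- immediate; the given factors are then compared with these.
  have hprod : Tendsto (fun n => ∏ i, ((Real.exp (-(s * v n i ^ 2 / 2)) : ℝ) : ℂ)) atTop
      (𝓝 (Real.exp (-(s * σ / 2)) : ℝ)) := by
    have : ∀ n, ∏ i, ((Real.exp (-(s * v n i ^ 2 / 2)) : ℝ) : ℂ)
        = (Real.exp (-(s * (∑ i, v n i ^ 2) / 2)) : ℝ) := by
      intro n
      rw [← Complex.ofReal_prod, ← Real.exp_sum, Finset.sum_neg_distrib, ← Finset.sum_div,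
        ← Finset.mul_sum]
    simp only [this]
    exact (Complex.continuous_ofReal.tendsto _).comp ((Real.continuous_exp.tendsto _).comp
      ((hv.const_mul s).div_const 2).neg)
  have hzero : Tendsto (fun n => ∏ i, φ (v n i) -
      ∏ i, ((Real.exp (-(s * v n i ^ 2 / 2)) : ℝ) : ℂ)) atTop (𝓝 0) := by
    rw [Metric.tendsto_atTop']
    intro η hη
    have hσ : 0 ≤ σ := ge_of_tendsto' hv fun n => Finset.sum_nonneg fun i _ => sq_nonneg _
    have hc : 0 < η / (2 * (σ + 1)) := by positivity
    obtain ⟨r, hr, hball⟩ := Metric.eventually_nhds_iff.1 (hdiff.def hc)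
    have hev := (hmax (r / 2) (by positivity)).and
      (hv.eventually (gt_mem_nhds (show σ < σ + 1 by linarith)))
    obtain ⟨N, hN⟩ := eventually_atTop.1 hev
    refine ⟨N, fun n hn => ?_⟩
    obtain ⟨h1, h2⟩ := hN n hn.le
    rw [dist_zero_right]
    refine (norm_prod_sub_prod_le_sum _ _ _ (fun i => hφ1 _) fun i => ?_).trans_lt ?_
    · rw [Complex.norm_real, Real.norm_of_nonneg (Real.exp_nonneg _), Real.exp_le_one_iff]
      have : 0 ≤ s * v n i ^ 2 / 2 := by positivity
      linarith
    · calc ∑ i, ‖φ (v n i) - ((Real.exp (-(s * v n i ^ 2 / 2)) : ℝ) : ℂ)‖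
          ≤ ∑ i, η / (2 * (σ + 1)) * v n i ^ 2 := by
            refine Finset.sum_le_sum fun i _ => ?_
            have := @hball (v n i) (by rw [dist_zero_right, Real.norm_eq_abs]; linarith [h1 i])
            rwa [Real.norm_of_nonneg (sq_nonneg _)] at this
        _ = η / (2 * (σ + 1)) * ∑ i, v n i ^ 2 := by rw [Finset.mul_sum]
        _ ≤ η / (2 * (σ + 1)) * (σ + 1) := by gcongr
        _ = η / 2 := by field_simp
        _ < η := by linarith
  simpa using hzero.add hprod

/-- A bounded variable has a second moment, so its characteristic function is twice continuously
differentiable and Taylor's formula applies; centring removes the linear term. -/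
theorem charFun_map_isLittleO {μ : Measure ℝ} [IsProbabilityMeasure μ]
    {h : ℝ → ℝ} (hh : Measurable h) {B : ℝ} (hB : ∀ x, |h x| ≤ B)
    (h0 : ∫ x, h x ∂μ = 0) :
    (fun t : ℝ => charFun (μ.map h) t - (1 - (∫ x, h x ^ 2 ∂μ) * t ^ 2 / 2 : ℝ)) =o[𝓝 0]
      fun t => t ^ 2 := by
  have hL : MemLp h 2 μ := MemLp.of_bound hh.aestronglyMeasurable B (ae_of_all _ hB)
  have hL' : MemLp id 2 (μ.map h) :=
    (memLp_map_measure_iff aestronglyMeasurable_id hh.aemeasurable).2 hL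
  have : IsProbabilityMeasure (μ.map h) := Measure.isProbabilityMeasure_map hh.aemeasurable
  have ht := taylor_isLittleO_univ (x₀ := (0 : ℝ)) (f := charFun (μ.map h)) (n := 2)
    (contDiff_charFun hL')
  simp only [sub_zero] at ht
  refine ht.congr_left fun t => ?_
  rw [taylorWithinEval_charFun_two_zero hh.aemeasurable hL', h0]
  simp [Pi.pow_apply]

theorem tendsto_charFun_map_sum {Ω : Type*} [MeasurableSpace Ω] {P : Measure Ω} {μ : Measure ℝ}
    [IsProbabilityMeasure μ] {ε : ℕ → Ω → ℝ} (hindep : iIndepFun ε P) (hlaw : ∀ i, HasLaw (ε i) μ P)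
    {h : ℝ → ℝ} (hh : Measurable h) {B : ℝ} (hB : ∀ x, |h x| ≤ B) (h0 : ∫ x, h x ∂μ = 0)
    {σ : ℝ} {v : (n : ℕ) → Fin n → ℝ} (hv : Tendsto (fun n => ∑ i, v n i ^ 2) atTop (𝓝 σ))
    (hmax : ∀ δ > 0, ∀ᶠ n in atTop, ∀ i, |v n i| ≤ δ) :
    Tendsto (fun n => charFun (P.map fun ω => ∑ i, v n i * h (ε i ω)) 1) atTop
      (𝓝 (Real.exp (-((∫ x, h x ^ 2 ∂μ) * σ / 2)) : ℝ)) := by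
  have : IsProbabilityMeasure (μ.map h) := Measure.isProbabilityMeasure_map hh.aemeasurable
  have hm : ∀ i, AEMeasurable (fun ω => h (ε i ω)) P := fun i =>
    hh.comp_aemeasurable (hlaw i).aemeasurable
  have hmap : ∀ i, P.map (fun ω => h (ε i ω)) = μ.map h := fun i => by
    rw [← (hlaw i).map_eq, AEMeasurable.map_map_of_aemeasurable hh.aemeasurable
      (hlaw i).aemeasurable]
    rfl
  have key : ∀ n, charFun (P.map fun ω => ∑ i, v n i * h (ε i ω)) 1 =
      ∏ i, charFun (μ.map h) (v n i) := by
    intro n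
    have hi : iIndepFun (fun (i : Fin n) ω => v n i * h (ε i ω)) P :=
      (hindep.precomp Fin.val_injective).comp (fun i x => v n i * h x)
        (fun i => measurable_const.mul hh)
    rw [iIndepFun.charFun_map_fun_sum_eq_prod (X := fun (i : Fin n) ω => v n i * h (ε i ω))
      (fun i => (hm i).const_mul _) hi]
    simp only [Finset.prod_apply]
    refine Finset.prod_congr rfl fun i _ => ?_
    rw [charFun_map_mul_comp (hm i), hmap, mul_one]
  simp only [key]
  exact tendsto_prod_of_isLittleO (integral_nonneg fun x => sq_nonneg _)
    (fun t => norm_charFun_le_one t) (charFun_map_isLittleO hh hB h0) hv hmax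

/-- Chebyshev's inequality for a sum of bounded functions of independent variables. -/
theorem measureReal_le_abs_sum_sub_le {Ω : Type*} [MeasurableSpace Ω] {P : Measure Ω}
    [IsProbabilityMeasure P] {μ : Measure ℝ} {ε : ℕ → Ω → ℝ} (hindep : iIndepFun ε P) (hlaw : ∀ i, HasLaw (ε i) μ P)
    {n : ℕ} {g : Fin n → ℝ → ℝ} (hg : ∀ i, Measurable (g i)) {B : Fin n → ℝ}
    (hB : ∀ i x, |g i x| ≤ B i) {c : ℝ} (hc : 0 < c) :
    P.real {ω | c ≤ |∑ i, g i (ε i ω) - ∑ i, ∫ x, g i x ∂μ|} ≤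
      (∑ i, ∫ x, g i x ^ 2 ∂μ) / c ^ 2 := by
  have hm : ∀ i : Fin n, AEMeasurable (fun ω => g i (ε i ω)) P := fun i =>
    (hg i).comp_aemeasurable (hlaw i).aemeasurable
  have hL : ∀ i : Fin n, MemLp (fun ω => g i (ε i ω)) 2 P := fun i =>
    MemLp.of_bound (hm i).aestronglyMeasurable (B i) (ae_of_all _ fun ω => hB i _)
  have hint : ∀ i : Fin n, ∫ ω, g i (ε i ω) ∂P = ∫ x, g i x ∂μ := fun i =>
    (hlaw i).integral_comp (hg i).aestronglyMeasurable
  have hint2 : ∀ i : Fin n, ∫ ω, g i (ε i ω) ^ 2 ∂P = ∫ x, g i x ^ 2 ∂μ := fun i =>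
    (hlaw i).integral_comp (f := fun x => g i x ^ 2) ((hg i).pow_const 2).aestronglyMeasurable
  have hi : iIndepFun (fun (i : Fin n) ω => g i (ε i ω)) P :=
    (hindep.precomp Fin.val_injective).comp (fun i x => g i x) hg
  have hvar : Var[∑ i : Fin n, fun ω => g i (ε i ω); P] ≤ ∑ i, ∫ x, g i x ^ 2 ∂μ := by
    rw [IndepFun.variance_sum (fun i _ => hL i) fun i _ j _ hij => hi.indepFun hij]
    refine Finset.sum_le_sum fun i _ => ?_
    rw [← hint2 i]
    exact variance_le_expectation_sq (hm i).aestronglyMeasurable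
  have hsumL : MemLp (∑ i : Fin n, fun ω => g i (ε i ω)) 2 P :=
    memLp_finsetSum' _ fun i _ => hL i
  have hmean : P[∑ i : Fin n, fun ω => g i (ε i ω)] = ∑ i, ∫ x, g i x ∂μ := by
    simp only [Finset.sum_apply]
    rw [integral_finsetSum _ fun i _ => (hL i).integrable one_le_two]
    exact Finset.sum_congr rfl fun i _ => hint i
  have := meas_ge_le_variance_div_sq hsumL hc
  rw [hmean] at this
  simp only [Finset.sum_apply] at this
  refine (ENNReal.toReal_le_of_le_ofReal (div_nonneg (variance_nonneg _ _) (sq_nonneg _)) this).trans ?_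
  gcongr

/-! ### Quantiles and scores -/

theorem continuous_cdf_of_nullSingletonClass (μ : Measure ℝ) [IsProbabilityMeasure μ]
    [NullSingletonClass μ] : Continuous (cdf μ) := by
  rw [continuous_iff_continuousAt]
  intro x
  rw [continuousAt_iff_continuous_left'_right']
  refine ⟨?_, ((cdf μ).right_continuous x).mono Set.Ioi_subset_Ici_self⟩
  have h1 : (cdf μ).measure {x} = 0 := by rw [measure_cdf]; exact measure_singleton x
  rw [StieltjesFunction.measure_singleton, ENNReal.ofReal_eq_zero, sub_nonpos] at h1
  have h2 : Function.leftLim (cdf μ) x = cdf μ x :=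
    le_antisymm ((cdf μ).mono.leftLim_le le_rfl) h1
  exact ((cdf μ).mono.continuousWithinAt_Iio_iff_leftLim_eq).2 h2

theorem cdf_quantile (μ : Measure ℝ) [IsProbabilityMeasure μ] [NullSingletonClass μ] {τ : ℝ}
    (hτ : τ ∈ Set.Ioo (0 : ℝ) 1) : cdf μ (quantile μ τ) = τ := by
  have hcont := continuous_cdf_of_nullSingletonClass μ
  have hne : {t : ℝ | τ ≤ cdf μ t}.Nonempty :=
    ((tendsto_cdf_atTop μ).eventually (lt_mem_nhds hτ.2)).exists.imp fun _ h => le_of_lt h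
  have hbdd : BddBelow {t : ℝ | τ ≤ cdf μ t} := by
    obtain ⟨t, ht⟩ := ((tendsto_cdf_atBot μ).eventually (gt_mem_nhds hτ.1)).exists
    refine ⟨t, fun s hs => ?_⟩
    by_contra! hst
    exact absurd (monotone_cdf μ hst.le) (not_le.2 (ht.trans_le hs))
  have hclosed : IsClosed {t : ℝ | τ ≤ cdf μ t} := isClosed_le continuous_const hcont
  refine le_antisymm ?_ (hclosed.csInf_mem hne hbdd)
  -- Points left of the infimum have cdf below `τ`; continuity carries the bound to the quantile
  -- itself.
  have hlt : ∀ t ∈ Set.Iio (quantile μ τ), cdf μ t ≤ τ := fun t ht =>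
    (not_le.1 fun h => absurd (csInf_le hbdd h) (not_le.2 ht)).le
  have hmem : quantile μ τ ∈ closure (Set.Iio (quantile μ τ)) := by simp
  exact closure_minimal hlt (isClosed_le hcont continuous_const) hmem

/-- The score `1{x ≤ bₖ} - τₖ` of the `k`-th quantile level. -/
noncomputable def quantileScore {K : ℕ} (τ b : Fin K → ℝ) (k : Fin K) (x : ℝ) : ℝ :=
  (if x ≤ b k then 1 else 0) - τ k

section Score
variable {K : ℕ} {τ b : Fin K → ℝ}

@[fun_prop]
theorem measurable_quantileScore (k : Fin K) : Measurable (quantileScore τ b k) :=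
  (Measurable.ite measurableSet_Iic measurable_const measurable_const).sub_const _

theorem abs_quantileScore_le (hτ : ∀ k, τ k ∈ Set.Ioo (0 : ℝ) 1) (k : Fin K) (x : ℝ) :
    |quantileScore τ b k x| ≤ 1 := by
  obtain ⟨h0, h1⟩ := hτ k
  unfold quantileScore
  rw [abs_le]
  split_ifs <;> constructor <;> linarith

theorem integral_quantileScore {μ : Measure ℝ} [IsProbabilityMeasure μ]
    (hb : ∀ k, cdf μ (b k) = τ k) (k : Fin K) : ∫ x, quantileScore τ b k x ∂μ = 0 := by
  unfold quantileScore
  rw [integral_sub (integrable_ite_le μ _) (integrable_const _), integral_ite_le_eq_cdf, hb]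
  simp

/-- The product of the two indicators is the indicator of x ≤ min(b_k, b_l), whose mean is min(τ_k,
τ_l). The covariance is therefore min(τ_k, τ_l) - τ_k τ_l, and τ_k τ_l is the product of minimum and
maximum. -/
theorem integral_quantileScore_mul {μ : Measure ℝ} [IsProbabilityMeasure μ]
    (hb : ∀ k, cdf μ (b k) = τ k) (k l : Fin K) :
    ∫ x, quantileScore τ b k x * quantileScore τ b l x ∂μ =
      min (τ k) (τ l) * (1 - max (τ k) (τ l)) := by
  have h1 : ∀ x, quantileScore τ b k x * quantileScore τ b l x =
      (if x ≤ min (b k) (b l) then (1 : ℝ) else 0) - τ l * (if x ≤ b k then (1 : ℝ) else 0)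
        - τ k * (if x ≤ b l then (1 : ℝ) else 0) + τ k * τ l := by
    intro x
    unfold quantileScore
    by_cases hk : x ≤ b k <;> by_cases hl : x ≤ b l <;> simp [hk, hl] <;> ring
  simp only [h1]
  rw [integral_add, integral_sub, integral_sub, integral_const_mul, integral_const_mul,
    integral_ite_le_eq_cdf, integral_ite_le_eq_cdf, integral_ite_le_eq_cdf,
    (monotone_cdf μ).map_min, hb, hb]
  · have := min_mul_max (τ k) (τ l)
    simp only [integral_const, probReal_univ, one_smul]
    linarith
  all_goals
    first
    | exact integrable_const _
    | exact integrable_ite_le μ _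
    | exact (integrable_ite_le μ _).const_mul _
    | exact (integrable_ite_le μ _).sub ((integrable_ite_le μ _).const_mul _)
    | exact ((integrable_ite_le μ _).sub ((integrable_ite_le μ _).const_mul _)).sub
        ((integrable_ite_le μ _).const_mul _)

theorem integral_sq_sum_quantileScore {μ : Measure ℝ} [IsProbabilityMeasure μ]
    (hτ : ∀ k, τ k ∈ Set.Ioo (0 : ℝ) 1) (hb : ∀ k, cdf μ (b k) = τ k) :
    ∫ x, (∑ k, quantileScore τ b k x) ^ 2 ∂μ =
      ∑ k, ∑ l, min (τ k) (τ l) * (1 - max (τ k) (τ l)) := by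
  have hint : ∀ k l, Integrable (fun x => quantileScore τ b k x * quantileScore τ b l x) μ := by
    intro k l
    refine Integrable.of_bound (C := 1) (by fun_prop) (ae_of_all _ fun x => ?_)
    rw [norm_mul]
    exact mul_le_one₀ (abs_quantileScore_le hτ k x) (norm_nonneg _) (abs_quantileScore_le hτ l x)
  simp only [sq, Finset.sum_mul_sum]
  rw [integral_finsetSum _ fun k _ => integrable_finsetSum _ fun l _ => hint k l]
  refine Finset.sum_congr rfl fun k _ => ?_
  rw [integral_finsetSum _ fun l _ => hint k l]
  exact Finset.sum_congr rfl fun l _ => integral_quantileScore_mul hb k l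

end Score

/-! ### Expansion and convexity of the objective -/

/-- Expansion of the composite quantile regression objective around the true parameters. -/
theorem cqrObjective_add_sub {n p K : ℕ} (τ : Fin K → ℝ) (X : Matrix (Fin n) (Fin p) ℝ)
    (β : EuclideanSpace ℝ (Fin p)) (e : Fin n → ℝ) (b c : Fin K → ℝ) (w : Fin p → ℝ) :
    cqrObjective τ X (linearResponse X β e) (b + c) (β + WithLp.toLp 2 w) -
        cqrObjective τ X (linearResponse X β e) b β =
      ∑ k, (∑ i, (c k + X i ⬝ᵥ w) * quantileScore τ b k (e i) +
        ∑ i, knightRem (e i - b k) (c k + X i ⬝ᵥ w)) := by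
  simp only [cqrObjective, ← Finset.sum_sub_distrib, ← Finset.sum_add_distrib]
  refine Finset.sum_congr rfl fun k _ => Finset.sum_congr rfl fun i _ => ?_
  have h1 : linearResponse X β e i - (b + c) k - X i ⬝ᵥ (β + WithLp.toLp 2 w).ofLp =
      (e i - b k) - (c k + X i ⬝ᵥ w) := by
    simp only [linearResponse, Pi.add_apply, WithLp.ofLp_add, dotProduct_add]
    ring
  have h2 : linearResponse X β e i - b k - X i ⬝ᵥ β.ofLp = e i - b k := by
    simp only [linearResponse]; ring
  rw [h1, h2, checkFn_sub_eq]
  simp only [quantileScore, sub_nonpos]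
  ring

theorem cqrObjective_comp_convexOn {n p K : ℕ} {τ : Fin K → ℝ} (hτ : ∀ k, τ k ∈ Set.Ioo (0 : ℝ) 1)
    (X : Matrix (Fin n) (Fin p) ℝ) (y : Fin n → ℝ) (β : EuclideanSpace ℝ (Fin p)) (b : Fin K → ℝ)
    (r : ℝ) :
    ConvexOn ℝ Set.univ (fun s : (Fin K → ℝ) × (Fin p → ℝ) =>
      cqrObjective τ X y (b + r • s.1) (β + WithLp.toLp 2 (r • s.2))) := by
  refine ⟨convex_univ, fun s _ s' _ a a' ha ha' haa => ?_⟩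
  simp only [cqrObjective, smul_eq_mul, Finset.mul_sum, ← Finset.sum_add_distrib]
  refine Finset.sum_le_sum fun k _ => Finset.sum_le_sum fun i _ => ?_
  have := (checkFn_convexOn (hτ k)).2
    (Set.mem_univ (y i - (b + r • s.1) k - X i ⬝ᵥ (β + WithLp.toLp 2 (r • s.2)).ofLp))
    (Set.mem_univ (y i - (b + r • s'.1) k - X i ⬝ᵥ (β + WithLp.toLp 2 (r • s'.2)).ofLp))
    ha ha' haa
  simp only [smul_eq_mul] at this
  refine le_trans (le_of_eq ?_) this
  congr 1
  obtain rfl : a' = 1 - a := by linarith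
  simp only [Pi.add_apply, Pi.smul_apply, smul_eq_mul, WithLp.ofLp_add, dotProduct_add,
    Prod.fst_add, Prod.snd_add, Prod.smul_fst, Prod.smul_snd, smul_add, dotProduct_smul]
  ring

/-- A continuous function homogeneous of degree two and positive off the origin dominates a multiple
of the squared norm. -/
theorem exists_mul_sq_norm_le {E : Type*} [NormedAddCommGroup E] [NormedSpace ℝ E]
    [FiniteDimensional ℝ E] {q : E → ℝ} (hq : Continuous q)
    (hhom : ∀ (r : ℝ) v, q (r • v) = r ^ 2 * q v) (hpos : ∀ v, v ≠ 0 → 0 < q v) :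
    ∃ c > 0, ∀ v, c * ‖v‖ ^ 2 ≤ q v := by
  have hq0 : q 0 = 0 := by simpa using hhom 0 0
  have key : ∃ c > 0, ∀ v ∈ Metric.sphere (0 : E) 1, c ≤ q v := by
    rcases (Metric.sphere (0 : E) 1).eq_empty_or_nonempty with h | h
    · exact ⟨1, one_pos, by simp [h]⟩
    · obtain ⟨z, hz, hzmin⟩ := (isCompact_sphere (0 : E) 1).exists_isMinOn h hq.continuousOn
      refine ⟨q z, hpos z ?_, fun v hv => hzmin hv⟩
      rintro rfl
      simp at hz
  obtain ⟨c, hc, hcq⟩ := key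
  refine ⟨c, hc, fun v => ?_⟩
  rcases eq_or_ne v 0 with rfl | hv
  · simp [hq0]
  · have hv' : 0 < ‖v‖ := norm_pos_iff.2 hv
    have h1 := hcq (‖v‖⁻¹ • v) (by simp [norm_smul, hv'.ne'])
    rw [hhom] at h1
    calc c * ‖v‖ ^ 2 ≤ (‖v‖⁻¹ ^ 2 * q v) * ‖v‖ ^ 2 := by gcongr
      _ = q v := by field_simp

/-! ### Consequences of the local expansion for the design and the remainders -/

section Design
variable {p : ℕ} {X : (n : ℕ) → Matrix (Fin n) (Fin p) ℝ} {C : Matrix (Fin p) (Fin p) ℝ}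
  {μ : Measure ℝ} [IsProbabilityMeasure μ] {f : ℝ → ℝ}

theorem LocalExpansion.tendsto_sum_meanKnightRem (hF : LocalExpansion X C (cdf μ) f)
    (a u₀ : ℝ) (u : Fin p → ℝ) :
    Tendsto (fun n : ℕ => ∑ i, meanKnightRem μ a ((u₀ + X n i ⬝ᵥ u) / √(n : ℝ))) atTop
      (𝓝 (1 / 2 * f a * (u₀ ^ 2 + u ⬝ᵥ (C *ᵥ u)))) := by
  refine (hF a u₀ u).congr' ?_
  filter_upwards [eventually_gt_atTop 0] with n hn
  rw [Finset.mul_sum]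
  exact Finset.sum_congr rfl fun i _ => integral_cdf_eq_meanKnightRem μ a _ hn

/-- The condition with u = 0 and u₀ = ±1 says that n times the mean remainder at ±1/√n tends to
f(a)/2. This replaces any continuity of the density at a. -/
theorem LocalExpansion.meanKnightRem_le (hF : LocalExpansion X C (cdf μ) f) {a : ℝ} (ha : 0 < f a)
    {e : ℝ} (he : 0 < e) :
    ∃ r > 0, ∀ w, |w| ≤ r → meanKnightRem μ a w ≤ (1 / 2 * f a + e) * w ^ 2 := by
  have h1 := hF.tendsto_sum_meanKnightRem a 1 0
  have h2 := hF.tendsto_sum_meanKnightRem a (-1) 0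
  simp at h1 h2
  refine exists_forall_abs_le_of_tendsto_mul (by linarith)
    (fun s s' => meanKnightRem_mono_right μ a) (fun s s' => meanKnightRem_anti_right μ a)
    ?_ ?_ ?_ he
  · simpa using h1
  · simpa [neg_div] using h2
  · rw [meanKnightRem_eq_integral]; simp

theorem tendsto_sum_sq_dotProduct
    (hX : Tendsto (fun n : ℕ => (1 / (n : ℝ)) • ((X n)ᵀ * X n)) atTop (𝓝 C)) (w : Fin p → ℝ) :
    Tendsto (fun n : ℕ => ∑ i, (X n i ⬝ᵥ w / √(n : ℝ)) ^ 2) atTop (𝓝 (w ⬝ᵥ (C *ᵥ w))) := by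
  have hcont : Continuous fun A : Matrix (Fin p) (Fin p) ℝ => w ⬝ᵥ (A *ᵥ w) :=
    continuous_const.dotProduct (continuous_id.matrix_mulVec continuous_const)
  refine ((hcont.tendsto C).comp hX).congr fun n => ?_
  have h1 : w ⬝ᵥ (((X n)ᵀ * X n) *ᵥ w) = ∑ i, (X n i ⬝ᵥ w) ^ 2 := by
    rw [← Matrix.mulVec_mulVec, Matrix.dotProduct_mulVec, Matrix.vecMul_transpose]
    simp only [dotProduct, Matrix.mulVec, sq]
  simp only [Function.comp, Matrix.smul_mulVec, dotProduct_smul, h1, smul_eq_mul, div_pow,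
    Real.sq_sqrt (Nat.cast_nonneg n), ← Finset.sum_div]
  rw [one_div_mul_eq_div]

/-- The local-expansion condition forces the rows of the design to be uniformly negligible. -/
theorem LocalExpansion.eventually_abs_dotProduct_le (hF : LocalExpansion X C (cdf μ) f)
    (hX : Tendsto (fun n : ℕ => (1 / (n : ℝ)) • ((X n)ᵀ * X n)) atTop (𝓝 C))
    (hf : ∀ t, 0 < f t) (w : Fin p → ℝ) {δ : ℝ} (hδ : 0 < δ) :
    ∀ᶠ n : ℕ in atTop, ∀ i, |X n i ⬝ᵥ w / √(n : ℝ)| ≤ δ := by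
  -- Any base point would do, as the density is positive everywhere; `0` is taken. Zero intercept
  -- and slope `l • w` produce all the dilations.
  refine eventually_forall_abs_le_of_tendsto_sum (D := meanKnightRem μ 0) (c := 1 / 2 * f 0)
    (by linarith [hf 0]) (meanKnightRem_le_abs μ 0) (fun e he => hF.meanKnightRem_le (hf 0) he)
    (tendsto_sum_sq_dotProduct hX w) (fun l => ?_) hδ
  have := hF.tendsto_sum_meanKnightRem 0 0 (l • w)
  simp only [zero_add, dotProduct_smul, smul_dotProduct, Matrix.mulVec_smul, smul_eq_mul,
    mul_div_assoc] at this
  convert this using 2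
  ring

theorem LocalExpansion.eventually_abs_add_dotProduct_le (hF : LocalExpansion X C (cdf μ) f)
    (hX : Tendsto (fun n : ℕ => (1 / (n : ℝ)) • ((X n)ᵀ * X n)) atTop (𝓝 C))
    (hf : ∀ t, 0 < f t) (u₀ : ℝ) (w : Fin p → ℝ) {δ : ℝ} (hδ : 0 < δ) :
    ∀ᶠ n : ℕ in atTop, ∀ i, |(u₀ + X n i ⬝ᵥ w) / √(n : ℝ)| ≤ δ := by
  have h1 : Tendsto (fun n : ℕ => |u₀| / √(n : ℝ)) atTop (𝓝 0) :=
    tendsto_const_nhds.div_atTop (Real.tendsto_sqrt_atTop.comp tendsto_natCast_atTop_atTop)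
  filter_upwards [hF.eventually_abs_dotProduct_le hX hf w (half_pos hδ),
    h1.eventually (gt_mem_nhds (half_pos hδ))] with n hn1 hn2 i
  rw [add_div]
  refine (abs_add_le _ _).trans ?_
  rw [abs_div u₀, abs_of_nonneg (Real.sqrt_nonneg _)]
  linarith [hn1 i]

/-- The sum of the Knight remainders converges in probability to its quadratic limit. -/
theorem LocalExpansion.tendsto_measureReal_knightRem (hF : LocalExpansion X C (cdf μ) f)
    (hX : Tendsto (fun n : ℕ => (1 / (n : ℝ)) • ((X n)ᵀ * X n)) atTop (𝓝 C))
    (hf : ∀ t, 0 < f t) {Ω : Type*} [MeasurableSpace Ω] {P : Measure Ω} [IsProbabilityMeasure P]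
    {ε : ℕ → Ω → ℝ} (hindep : iIndepFun ε P) (hlaw : ∀ i, HasLaw (ε i) μ P)
    (a u₀ : ℝ) (u : Fin p → ℝ) {η : ℝ} (hη : 0 < η) :
    Tendsto (fun n : ℕ => P.real {ω | η ≤
        |∑ i : Fin n, knightRem (ε i ω - a) ((u₀ + X n i ⬝ᵥ u) / √(n : ℝ)) -
          1 / 2 * f a * (u₀ ^ 2 + u ⬝ᵥ (C *ᵥ u))|}) atTop (𝓝 0) := by
  have hmean := hF.tendsto_sum_meanKnightRem a u₀ u
  set V := 1 / 2 * f a * (u₀ ^ 2 + u ⬝ᵥ (C *ᵥ u))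
  refine tendsto_order.2 ⟨fun r hr => Eventually.of_forall fun n => hr.trans_le
    measureReal_nonneg, fun r hr => ?_⟩
  have hV : 0 < |V| + 1 := by positivity
  -- Row bound chosen so that Chebyshev's inequality at level `η / 2` yields `r / 2`; the other `η /
  -- 2` absorbs the deviation of the mean from `V`.
  have hδ : 0 < r * (η / 2) ^ 2 / (2 * (|V| + 1)) := by positivity
  filter_upwards [hF.eventually_abs_add_dotProduct_le hX hf u₀ u hδ,
    hmean.eventually (Metric.ball_mem_nhds V (half_pos hη)),
    hmean.eventually (gt_mem_nhds (show V < |V| + 1 by linarith [le_abs_self V]))] with n h1 h2 h3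
  set v : Fin n → ℝ := fun i => (u₀ + X n i ⬝ᵥ u) / √(n : ℝ)
  rw [Real.dist_eq] at h2
  have hcheb := measureReal_le_abs_sum_sub_le hindep hlaw
    (g := fun (i : Fin n) x => knightRem (x - a) (v i))
    (fun i => (measurable_knightRem _).comp (measurable_id.sub_const a)) (B := fun i => |v i|)
    (fun i x => by rw [abs_of_nonneg (knightRem_nonneg _ _)]; exact knightRem_le_abs _ _)
    (half_pos hη)
  have hsq : ∑ i, ∫ x, knightRem (x - a) (v i) ^ 2 ∂μ ≤
      r * (η / 2) ^ 2 / (2 * (|V| + 1)) * (|V| + 1) := by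
    calc ∑ i, ∫ x, knightRem (x - a) (v i) ^ 2 ∂μ
        ≤ ∑ i, r * (η / 2) ^ 2 / (2 * (|V| + 1)) * meanKnightRem μ a (v i) := by
          refine Finset.sum_le_sum fun i _ => (integral_sq_knightRem_le μ a _).trans ?_
          exact mul_le_mul_of_nonneg_right (h1 i)
            (integral_nonneg fun x => knightRem_nonneg _ _)
      _ ≤ _ := by
          rw [← Finset.mul_sum]
          exact mul_le_mul_of_nonneg_left h3.le hδ.le
  calc _ ≤ P.real {ω | η / 2 ≤ |∑ i : Fin n, knightRem (ε i ω - a) (v i) -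
        ∑ i, ∫ x, knightRem (x - a) (v i) ∂μ|} := by
        refine measureReal_mono fun ω hω => ?_
        simp only [Set.mem_ofPred_eq] at hω ⊢
        have := abs_sub_le (∑ i : Fin n, knightRem (ε i ω - a) (v i))
          (∑ i, meanKnightRem μ a (v i)) V
        simp only [meanKnightRem] at this h2
        linarith
    _ ≤ (r * (η / 2) ^ 2 / (2 * (|V| + 1)) * (|V| + 1)) / (η / 2) ^ 2 := hcheb.trans (by gcongr)
    _ = r / 2 := by field_simp
    _ < r := by linarith

end Design

/-- Weighted sums of a bounded centred function of the errors are bounded in probability. -/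
theorem exists_eventually_measureReal_abs_sum_le {Ω : Type*} [MeasurableSpace Ω] {P : Measure Ω}
    [IsProbabilityMeasure P] {μ : Measure ℝ} {ε : ℕ → Ω → ℝ} (hindep : iIndepFun ε P)
    (hlaw : ∀ i, HasLaw (ε i) μ P) {h : ℝ → ℝ} (hh : Measurable h) {B : ℝ} (hB : ∀ x, |h x| ≤ B)
    (h0 : ∫ x, h x ∂μ = 0) {σ : ℝ} {v : (n : ℕ) → Fin n → ℝ}
    (hv : Tendsto (fun n => ∑ i, v n i ^ 2) atTop (𝓝 σ)) {r : ℝ} (hr : 0 < r) :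
    ∃ M, ∀ L ≥ M, ∀ᶠ n in atTop, P.real {ω | L ≤ |∑ i, v n i * h (ε i ω)|} ≤ r := by
  set s := ∫ x, h x ^ 2 ∂μ
  have hs : 0 ≤ s := integral_nonneg fun x => sq_nonneg _
  have hσ : 0 ≤ σ := ge_of_tendsto' hv fun n => Finset.sum_nonneg fun i _ => sq_nonneg _
  refine ⟨max 1 (s * (σ + 1) / r), fun L hL => ?_⟩
  have hL1 : 1 ≤ L := (le_max_left _ _).trans hL
  have hL2 : s * (σ + 1) / r ≤ L := (le_max_right _ _).trans hL
  filter_upwards [hv.eventually (gt_mem_nhds (show σ < σ + 1 by linarith))] with n hn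
  have hcheb := measureReal_le_abs_sum_sub_le hindep hlaw
    (g := fun (i : Fin n) x => v n i * h x) (fun i => measurable_const.mul hh)
    (B := fun i => |v n i| * B)
    (fun i x => by rw [abs_mul]; exact mul_le_mul_of_nonneg_left (hB x) (abs_nonneg _))
    (c := L) (by linarith)
  simp only [integral_const_mul, h0, mul_zero, Finset.sum_const_zero, sub_zero, mul_pow,
    ← Finset.sum_mul] at hcheb
  refine hcheb.trans ?_
  rw [div_le_iff₀ (by positivity)]
  rw [div_le_iff₀ hr] at hL2
  have h1 : (∑ i, v n i ^ 2) * s ≤ (σ + 1) * s := by gcongr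
  have h2 : L * r ≤ L ^ 2 * r := by gcongr; nlinarith
  linarith

/-! ### The limiting quadratic and its minimizer -/

section Quad
variable {K p : ℕ}

/-- The quadratic part of the limiting objective. -/
noncomputable def cqrQuad (g : Fin K → ℝ) (C : Matrix (Fin p) (Fin p) ℝ)
    (s : (Fin K → ℝ) × (Fin p → ℝ)) : ℝ :=
  ∑ k, 1 / 2 * g k * (s.1 k ^ 2 + s.2 ⬝ᵥ (C *ᵥ s.2))

/-- The minimizer of the quadratic objective with linear part given by `z` and `Z`. -/
noncomputable def cqrCenter (g : Fin K → ℝ) (C : Matrix (Fin p) (Fin p) ℝ) (z : Fin K → ℝ)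
    (Z : Fin p → ℝ) : (Fin K → ℝ) × (Fin p → ℝ) :=
  (fun k => -(g k)⁻¹ * z k, -(∑ k, g k)⁻¹ • (C⁻¹ *ᵥ Z))

theorem continuous_cqrQuad (g : Fin K → ℝ) (C : Matrix (Fin p) (Fin p) ℝ) :
    Continuous (cqrQuad g C) := by
  unfold cqrQuad
  refine continuous_finsetSum _ fun k _ => continuous_const.mul (Continuous.add (by fun_prop) ?_)
  exact continuous_snd.dotProduct (continuous_const.matrix_mulVec continuous_snd)

theorem cqrQuad_smul (g : Fin K → ℝ) (C : Matrix (Fin p) (Fin p) ℝ) (r : ℝ)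
    (s : (Fin K → ℝ) × (Fin p → ℝ)) : cqrQuad g C (r • s) = r ^ 2 * cqrQuad g C s := by
  simp only [cqrQuad, Finset.mul_sum, Prod.smul_fst, Prod.smul_snd, Pi.smul_apply, smul_eq_mul,
    Matrix.mulVec_smul, dotProduct_smul, smul_dotProduct]
  exact Finset.sum_congr rfl fun k _ => by ring

theorem dotProduct_mulVec_self_nonneg {C : Matrix (Fin p) (Fin p) ℝ} (hC : C.PosDef)
    (u : Fin p → ℝ) : 0 ≤ u ⬝ᵥ (C *ᵥ u) := by
  simpa using hC.posSemidef.dotProduct_mulVec_nonneg u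

theorem cqrQuad_pos {g : Fin K → ℝ} (hg : ∀ k, 0 < g k) (hK : 0 < K)
    {C : Matrix (Fin p) (Fin p) ℝ} (hC : C.PosDef) {s : (Fin K → ℝ) × (Fin p → ℝ)} (hs : s ≠ 0) :
    0 < cqrQuad g C s := by
  have h0 : ∀ k ∈ Finset.univ, 0 ≤ 1 / 2 * g k * (s.1 k ^ 2 + s.2 ⬝ᵥ (C *ᵥ s.2)) := fun k _ => by
    have := dotProduct_mulVec_self_nonneg hC s.2
    have := hg k
    positivity
  refine (Finset.sum_nonneg h0).lt_of_ne' fun hzero => hs ?_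
  have h1 := fun k => (Finset.sum_eq_zero_iff_of_nonneg h0).1 hzero k (Finset.mem_univ k)
  have h2 : ∀ k, s.1 k ^ 2 + s.2 ⬝ᵥ (C *ᵥ s.2) = 0 := fun k => by
    have := hg k
    exact (mul_eq_zero.1 (h1 k)).resolve_left (by positivity)
  have hnn := dotProduct_mulVec_self_nonneg hC s.2
  refine Prod.ext (funext fun k => ?_) ?_
  · have := h2 k
    have h3 : s.1 k ^ 2 = 0 := by nlinarith [sq_nonneg (s.1 k)]
    simpa using h3
  · by_contra hne
    have h4 : 0 < s.2 ⬝ᵥ (C *ᵥ s.2) := by simpa using hC.dotProduct_mulVec_pos hne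
    have := h2 ⟨0, hK⟩
    nlinarith [sq_nonneg (s.1 ⟨0, hK⟩)]

theorem dotProduct_mulVec_comm_of_isHermitian {A : Matrix (Fin p) (Fin p) ℝ} (hA : A.IsHermitian)
    (x y : Fin p → ℝ) : x ⬝ᵥ (A *ᵥ y) = (A *ᵥ x) ⬝ᵥ y := by
  have hT : Aᵀ = A := by simpa using hA.eq
  rw [Matrix.dotProduct_mulVec, ← Matrix.mulVec_transpose, hT]

/-- Completing the square. -/
theorem linear_add_cqrQuad_eq {g : Fin K → ℝ} (hg : ∀ k, 0 < g k) (hK : 0 < K)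
    {C : Matrix (Fin p) (Fin p) ℝ} (hC : C.PosDef) (z : Fin K → ℝ) (Z : Fin p → ℝ)
    (s : (Fin K → ℝ) × (Fin p → ℝ)) :
    ∑ k, s.1 k * z k + s.2 ⬝ᵥ Z + cqrQuad g C s =
      cqrQuad g C (s - cqrCenter g C z Z) - cqrQuad g C (cqrCenter g C z Z) := by
  have : Nonempty (Fin K) := ⟨⟨0, hK⟩⟩
  have hG : 0 < ∑ k, g k := Finset.sum_pos (fun k _ => hg k) Finset.univ_nonempty
  set m := cqrCenter g C z Z with hm
  have hCm : C *ᵥ m.2 = -(∑ k, g k)⁻¹ • Z := by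
    rw [hm, cqrCenter, Matrix.mulVec_smul, Matrix.mulVec_mulVec,
      Matrix.mul_nonsing_inv C ((Matrix.isUnit_iff_isUnit_det C).1 hC.isUnit), Matrix.one_mulVec]
  have hquad : (s - m).2 ⬝ᵥ (C *ᵥ (s - m).2) =
      s.2 ⬝ᵥ (C *ᵥ s.2) + 2 * (∑ k, g k)⁻¹ * (s.2 ⬝ᵥ Z) + m.2 ⬝ᵥ (C *ᵥ m.2) := by
    have h1 : m.2 ⬝ᵥ (C *ᵥ s.2) = s.2 ⬝ᵥ (C *ᵥ m.2) := by
      rw [dotProduct_mulVec_comm_of_isHermitian hC.isHermitian, dotProduct_comm]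
    have h2 : s.2 ⬝ᵥ (C *ᵥ m.2) = -(∑ k, g k)⁻¹ * (s.2 ⬝ᵥ Z) := by
      rw [hCm, dotProduct_smul, smul_eq_mul]
    rw [Prod.snd_sub, Matrix.mulVec_sub, dotProduct_sub, sub_dotProduct, sub_dotProduct, h1, h2]
    ring
  -- The slope is shared by all levels; splitting its linear term in proportion to `g k` lets the
  -- identity be checked level by level.
  have hlin : s.2 ⬝ᵥ Z = ∑ k, g k * ((∑ k, g k)⁻¹ * (s.2 ⬝ᵥ Z)) := by
    rw [← Finset.sum_mul, mul_inv_cancel_left₀ hG.ne']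
  simp only [cqrQuad, hquad]
  nth_rewrite 1 [hlin]
  rw [← Finset.sum_add_distrib, ← Finset.sum_add_distrib, ← Finset.sum_sub_distrib]
  refine Finset.sum_congr rfl fun k _ => ?_
  have h3 : g k * m.1 k = -z k := by
    have := (hg k).ne'
    rw [hm, cqrCenter]
    field_simp
  simp only [Prod.fst_sub, Pi.sub_apply]
  have h4 : s.1 k * z k = - (g k * m.1 k) * s.1 k := by rw [h3]; ring
  rw [h4]
  ring

/-- By symmetry of C⁻¹, each linear functional of the slope centre is a weighted sum over rows, to
which the Chebyshev bound and the scalar central limit theorem apply. -/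
theorem dotProduct_cqrCenter_snd {n : ℕ} (g : Fin K → ℝ) {C : Matrix (Fin p) (Fin p) ℝ}
    (hC : C.PosDef) (z : Fin K → ℝ) (X : Matrix (Fin n) (Fin p) ℝ) (h : Fin n → ℝ) (r : ℝ)
    (t : Fin p → ℝ) :
    t ⬝ᵥ (cqrCenter g C z (Xᵀ *ᵥ fun i => r⁻¹ * h i)).2 =
      ∑ i, X i ⬝ᵥ (-(∑ k, g k)⁻¹ • (C⁻¹ *ᵥ t)) / r * h i := by
  rw [cqrCenter, dotProduct_smul, dotProduct_mulVec_comm_of_isHermitian hC.inv.isHermitian,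
    Matrix.mulVec_transpose, dotProduct_comm, ← Matrix.dotProduct_mulVec, smul_eq_mul]
  simp only [dotProduct_smul, smul_eq_mul]
  rw [dotProduct, Finset.mul_sum]
  refine Finset.sum_congr rfl fun i _ => ?_
  rw [Matrix.mulVec]
  ring

end Quad

/-- Finitely many sequences of random variables, each bounded in probability, are jointly bounded
in probability. -/
theorem exists_eventually_measureReal_exists_le {Ω ι : Type*} [MeasurableSpace Ω] {P : Measure Ω}
    [IsProbabilityMeasure P] [Fintype ι] {Y : ι → ℕ → Ω → ℝ}
    (hY : ∀ i, ∀ r > 0, ∃ M, ∀ L ≥ M, ∀ᶠ n in atTop, P.real {ω | L ≤ |Y i n ω|} ≤ r)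
    {r : ℝ} (hr : 0 < r) :
    ∃ M ≥ 0, ∀ᶠ n in atTop, P.real {ω | ∃ i, M ≤ |Y i n ω|} ≤ r := by
  have hr' : 0 < r / (Fintype.card ι + 1) := by positivity
  choose M hM using fun i => hY i _ hr'
  refine ⟨∑ i, |M i|, Finset.sum_nonneg fun i _ => abs_nonneg _, ?_⟩
  have hev : ∀ᶠ n in atTop, ∀ i, P.real {ω | ∑ i, |M i| ≤ |Y i n ω|} ≤ r / (Fintype.card ι + 1) :=
    eventually_all.2 fun i => hM i _ ((le_abs_self _).trans
      (Finset.single_le_sum (f := fun i => |M i|) (fun j _ => abs_nonneg _) (Finset.mem_univ i)))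
  filter_upwards [hev] with n hn
  have : {ω | ∃ i, ∑ i, |M i| ≤ |Y i n ω|} = ⋃ i, {ω | ∑ i, |M i| ≤ |Y i n ω|} := by
    ext ω; simp
  rw [this]
  refine (measureReal_iUnion_fintype_le _).trans ((Finset.sum_le_sum fun i _ => hn i).trans ?_)
  rw [Finset.sum_const, Finset.card_univ, nsmul_eq_mul, mul_div_assoc', div_le_iff₀ (by positivity)]
  nlinarith

/-! ### Asymptotic equivalence of estimator and centre -/

section Asymptotics
variable {p K : ℕ} {τ b : Fin K → ℝ} {f : ℝ → ℝ} {C : Matrix (Fin p) (Fin p) ℝ}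

/-- The centre of the quadratic approximation of the rescaled objective for the errors `e`. -/
noncomputable def cqrScoreCenter (τ b : Fin K → ℝ) (f : ℝ → ℝ) (C : Matrix (Fin p) (Fin p) ℝ)
    {n : ℕ} (X : Matrix (Fin n) (Fin p) ℝ) (e : Fin n → ℝ) : (Fin K → ℝ) × (Fin p → ℝ) :=
  cqrCenter (fun k => f (b k)) C (fun k => ∑ i, (√(n : ℝ))⁻¹ * quantileScore τ b k (e i))
    (Xᵀ *ᵥ fun i => (√(n : ℝ))⁻¹ * ∑ k, quantileScore τ b k (e i))

/-- The rescaled objective minus its quadratic approximation is a sum of centred Knight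
remainders. -/
theorem cqrObjective_sub_quad_eq (hf : ∀ t, 0 < f t) (hK : 0 < K) (hC : C.PosDef) {n : ℕ}
    (X : Matrix (Fin n) (Fin p) ℝ) (β : EuclideanSpace ℝ (Fin p)) (e : Fin n → ℝ)
    (s : (Fin K → ℝ) × (Fin p → ℝ)) :
    cqrObjective τ X (linearResponse X β e) (b + (√(n : ℝ))⁻¹ • s.1)
        (β + WithLp.toLp 2 ((√(n : ℝ))⁻¹ • s.2)) -
      (cqrQuad (fun k => f (b k)) C (s - cqrScoreCenter τ b f C X e) +
        (cqrObjective τ X (linearResponse X β e) b β -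
          cqrQuad (fun k => f (b k)) C (cqrScoreCenter τ b f C X e))) =
    ∑ k, (∑ i, knightRem (e i - b k) ((s.1 k + X i ⬝ᵥ s.2) / √(n : ℝ)) -
      1 / 2 * f (b k) * (s.1 k ^ 2 + s.2 ⬝ᵥ (C *ᵥ s.2))) := by
  have h1 := cqrObjective_add_sub τ X β e b ((√(n : ℝ))⁻¹ • s.1) ((√(n : ℝ))⁻¹ • s.2)
  have h2 := linear_add_cqrQuad_eq (fun k => hf (b k)) hK hC
    (fun k => ∑ i, (√(n : ℝ))⁻¹ * quantileScore τ b k (e i))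
    (Xᵀ *ᵥ fun i => (√(n : ℝ))⁻¹ * ∑ k, quantileScore τ b k (e i)) s
  have h3 : s.2 ⬝ᵥ (Xᵀ *ᵥ fun i => (√(n : ℝ))⁻¹ * ∑ k, quantileScore τ b k (e i)) =
      ∑ k, ∑ i, (√(n : ℝ))⁻¹ * (X i ⬝ᵥ s.2) * quantileScore τ b k (e i) := by
    rw [Matrix.mulVec_transpose, dotProduct_comm, ← Matrix.dotProduct_mulVec, Finset.sum_comm,
      dotProduct]
    refine Finset.sum_congr rfl fun i _ => ?_
    rw [← Finset.mul_sum, Matrix.mulVec]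
    ring
  have h4 : ∀ k i, ((√(n : ℝ))⁻¹ • s.1) k + X i ⬝ᵥ ((√(n : ℝ))⁻¹ • s.2) =
      (s.1 k + X i ⬝ᵥ s.2) / √(n : ℝ) := by
    intro k i
    rw [Pi.smul_apply, dotProduct_smul, smul_eq_mul, smul_eq_mul]
    ring
  have h5 : ∑ k, ∑ i, (s.1 k + X i ⬝ᵥ s.2) / √(n : ℝ) * quantileScore τ b k (e i) =
      ∑ k, s.1 k * ∑ i, (√(n : ℝ))⁻¹ * quantileScore τ b k (e i) +
        s.2 ⬝ᵥ (Xᵀ *ᵥ fun i => (√(n : ℝ))⁻¹ * ∑ k, quantileScore τ b k (e i)) := by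
    rw [h3, ← Finset.sum_add_distrib]
    refine Finset.sum_congr rfl fun k _ => ?_
    rw [Finset.mul_sum, ← Finset.sum_add_distrib]
    exact Finset.sum_congr rfl fun i _ => by ring
  simp only [h4, Finset.sum_add_distrib] at h1
  rw [h5] at h1
  rw [Finset.sum_sub_distrib]
  simp only [cqrScoreCenter]
  unfold cqrQuad at h2 ⊢
  linarith

/-- The centre of the quadratic approximation is bounded in probability. -/
theorem exists_eventually_measureReal_lt_norm_cqrScoreCenter {Ω : Type*}
    [MeasurableSpace Ω] {P : Measure Ω} [IsProbabilityMeasure P] {μ : Measure ℝ}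
    [IsProbabilityMeasure μ] {ε : ℕ → Ω → ℝ} {X : (n : ℕ) → Matrix (Fin n) (Fin p) ℝ}
    (hτ : ∀ k, τ k ∈ Set.Ioo (0 : ℝ) 1) (hb : ∀ k, cdf μ (b k) = τ k)
    (hindep : iIndepFun ε P) (hlaw : ∀ i, HasLaw (ε i) μ P) (hC : C.PosDef)
    (hX : Tendsto (fun n : ℕ => (1 / (n : ℝ)) • ((X n)ᵀ * X n)) atTop (𝓝 C))
    {r : ℝ} (hr : 0 < r) :
    ∃ M, ∀ᶠ n : ℕ in atTop,
      P.real {ω | M < ‖cqrScoreCenter τ b f C (X n) (fun i => ε i ω)‖} ≤ r := by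
  set m : ℕ → Ω → (Fin K → ℝ) × (Fin p → ℝ) :=
    fun n ω => cqrScoreCenter τ b f C (X n) (fun i => ε i ω) with hm
  have hcoord : ∀ j : Fin K ⊕ Fin p, ∀ r > 0, ∃ M, ∀ L ≥ M, ∀ᶠ n in atTop,
      P.real {ω | L ≤ |(Sum.elim (fun k n ω => (m n ω).1 k) (fun j n ω => (m n ω).2 j) j :
        ℕ → Ω → ℝ) n ω|} ≤ r := by
    rintro (k | j) r hr
    · have hv : Tendsto (fun n : ℕ => ∑ _i : Fin n, (-(f (b k))⁻¹ * (√(n : ℝ))⁻¹) ^ 2) atTop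
          (𝓝 ((f (b k))⁻¹ ^ 2)) := by
        refine tendsto_const_nhds.congr' ?_
        filter_upwards [eventually_gt_atTop 0] with n hn
        have hn' : (0 : ℝ) < n := by exact_mod_cast hn
        rw [Finset.sum_const, Finset.card_univ, Fintype.card_fin, nsmul_eq_mul, mul_pow, neg_sq,
          inv_pow (√(n : ℝ)), Real.sq_sqrt hn'.le]
        field_simp
      obtain ⟨M, hM⟩ := exists_eventually_measureReal_abs_sum_le hindep hlaw
        (measurable_quantileScore k) (abs_quantileScore_le hτ k) (integral_quantileScore hb k)
        hv hr
      refine ⟨M, fun L hL => (hM L hL).mono fun n hn => ?_⟩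
      simp only [Sum.elim_inl, hm, cqrScoreCenter, cqrCenter, Finset.mul_sum]
      simpa only [mul_assoc] using hn
    · obtain ⟨M, hM⟩ := exists_eventually_measureReal_abs_sum_le hindep hlaw
        (h := fun x => ∑ k, quantileScore τ b k x) (by fun_prop) (B := K)
        (fun x => (Finset.abs_sum_le_sum_abs _ _).trans
          ((Finset.sum_le_sum fun k _ => abs_quantileScore_le hτ k x).trans (by simp)))
        (by
          rw [integral_finsetSum]
          · exact Finset.sum_eq_zero fun k _ => integral_quantileScore hb k
          · exact fun k _ => Integrable.of_bound (C := 1) (by fun_prop)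
              (ae_of_all _ fun x => abs_quantileScore_le hτ k x))
        (tendsto_sum_sq_dotProduct hX
          (-(∑ k, f (b k))⁻¹ • (C⁻¹ *ᵥ Pi.single j 1))) hr
      refine ⟨M, fun L hL => (hM L hL).mono fun n hn => ?_⟩
      have h1 : ∀ ω, (m n ω).2 j = ∑ i, X n i ⬝ᵥ (-(∑ k, f (b k))⁻¹ • (C⁻¹ *ᵥ Pi.single j 1)) /
          √(n : ℝ) * ∑ k, quantileScore τ b k (ε i ω) := by
        intro ω
        rw [← single_one_dotProduct j (m n ω).2]
        exact dotProduct_cqrCenter_snd (fun k => f (b k)) hC _ (X n) _ _ _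
      simp only [Sum.elim_inr, h1]
      exact hn
  obtain ⟨M, hM0, hM⟩ := exists_eventually_measureReal_exists_le hcoord hr
  refine ⟨M, hM.mono fun n hn => le_trans (measureReal_mono fun ω hω => ?_) hn⟩
  by_contra hcon
  simp only [Set.mem_ofPred_eq, not_exists, not_le] at hcon hω
  refine hω.not_ge (norm_prod_le_iff.2 ⟨?_, ?_⟩)
  · exact (pi_norm_le_iff_of_nonneg hM0).2 fun k => (hcon (Sum.inl k)).le
  · exact (pi_norm_le_iff_of_nonneg hM0).2 fun j => (hcon (Sum.inr j)).le

/-- The rescaled estimation error is asymptotically equivalent to the centre of the quadratic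
approximation. -/
theorem tendsto_measureReal_le_norm_sub_cqrScoreCenter {Ω : Type*}
    [MeasurableSpace Ω] {P : Measure Ω} [IsProbabilityMeasure P] {μ : Measure ℝ}
    [IsProbabilityMeasure μ] {ε : ℕ → Ω → ℝ} {X : (n : ℕ) → Matrix (Fin n) (Fin p) ℝ} (hK : 0 < K)
    (hτ : ∀ k, τ k ∈ Set.Ioo (0 : ℝ) 1) (hb : ∀ k, cdf μ (b k) = τ k) (hf : ∀ t, 0 < f t)
    (hindep : iIndepFun ε P) (hlaw : ∀ i, HasLaw (ε i) μ P) (hC : C.PosDef)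
    (hX : Tendsto (fun n : ℕ => (1 / (n : ℝ)) • ((X n)ᵀ * X n)) atTop (𝓝 C))
    (hF : LocalExpansion X C (cdf μ) f)
    (βstar : EuclideanSpace ℝ (Fin p)) (bhat : ℕ → Ω → Fin K → ℝ)
    (βhat : ℕ → Ω → EuclideanSpace ℝ (Fin p))
    (hmin : ∀ n, ∀ᵐ ω ∂P, IsCQRMinimizer τ (X n)
      (linearResponse (X n) βstar (fun i => ε i ω)) (bhat n ω) (βhat n ω))
    {δ : ℝ} (hδ : 0 < δ) :
    Tendsto (fun n : ℕ => P.real {ω | δ ≤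
      ‖(√(n : ℝ) • (bhat n ω - b), √(n : ℝ) • (βhat n ω - βstar).ofLp) -
        cqrScoreCenter τ b f C (X n) (fun i => ε i ω)‖}) atTop (𝓝 0) := by
  refine tendsto_order.2 ⟨fun r hr => Eventually.of_forall fun n => hr.trans_le
    measureReal_nonneg, fun r hr => ?_⟩
  have hg : ∀ k, 0 < (fun k => f (b k)) k := fun k => hf (b k)
  obtain ⟨c, hc, hqc⟩ := exists_mul_sq_norm_le (continuous_cqrQuad (fun k => f (b k)) C)
    (fun r v => cqrQuad_smul _ _ r v) (fun v hv => cqrQuad_pos hg hK hC hv)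
  obtain ⟨M, hM⟩ := exists_eventually_measureReal_lt_norm_cqrScoreCenter (f := f) hτ hb hindep hlaw
    hC hX (half_pos hr)
  -- The net depends on `M` and `δ` but not on `n` or `ω`, so only finitely many pointwise limits in
  -- probability are used.
  obtain ⟨T, η, hη, hT⟩ := exists_finset_norm_minimizer_sub_lt
    (continuous_cqrQuad (fun k => f (b k)) C) (by simp [cqrQuad]) hc hqc M hδ
  have hK' : (0 : ℝ) < K := by exact_mod_cast hK
  have hη' : 0 < η / K := by positivity
  set bad : ((Fin K → ℝ) × (Fin p → ℝ)) → Fin K → ℕ → Set Ω := fun g k n => {ω | η / K ≤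
    |∑ i : Fin n, knightRem (ε i ω - b k) ((g.1 k + X n i ⬝ᵥ g.2) / √(n : ℝ)) -
      1 / 2 * f (b k) * (g.1 k ^ 2 + g.2 ⬝ᵥ (C *ᵥ g.2))|} with hbad
  have hlim : Tendsto (fun n => ∑ g ∈ T, ∑ k, P.real (bad g k n)) atTop (𝓝 0) := by
    have : (0 : ℝ) = ∑ g ∈ T, ∑ k : Fin K, 0 := by simp
    rw [this]
    exact tendsto_finsetSum _ fun g _ => tendsto_finsetSum _ fun k _ =>
      hF.tendsto_measureReal_knightRem hX hf hindep hlaw (b k) (g.1 k) g.2 hη'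
  filter_upwards [hM, hlim.eventually (gt_mem_nhds (half_pos hr)), eventually_gt_atTop 0]
    with n hn1 hn2 hn
  have hs : √(n : ℝ) ≠ 0 := (Real.sqrt_pos.2 (by exact_mod_cast hn)).ne'
  set small : Set Ω := {ω | M < ‖cqrScoreCenter τ b f C (X n) (fun i => ε i ω)‖}
  set exc : Set Ω := small ∪ ⋃ g ∈ T, ⋃ k, bad g k n with hexc
  -- Almost sure inclusion and monotonicity of outer measure suffice here, so the intercept
  -- estimators need not be measurable.
  have hsub : {ω | δ ≤ ‖(√(n : ℝ) • (bhat n ω - b), √(n : ℝ) • (βhat n ω - βstar).ofLp) -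
      cqrScoreCenter τ b f C (X n) (fun i => ε i ω)‖} ≤ᵐ[P] exc := by
    filter_upwards [hmin n] with ω hω hωδ
    by_contra hcon
    have hnot : ω ∉ exc := hcon
    simp only [hexc, Set.mem_union, Set.mem_iUnion, not_or, not_exists] at hnot
    obtain ⟨hω1, hω2⟩ := hnot
    refine (not_le.2 (hT (fun s => cqrObjective τ (X n)
      (linearResponse (X n) βstar (fun i => ε i ω)) (b + (√(n : ℝ))⁻¹ • s.1)
        (βstar + WithLp.toLp 2 ((√(n : ℝ))⁻¹ • s.2))) _ _
      (cqrObjective τ (X n) (linearResponse (X n) βstar (fun i => ε i ω)) b βstar -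
        cqrQuad (fun k => f (b k)) C (cqrScoreCenter τ b f C (X n) (fun i => ε i ω)))
      (cqrObjective_comp_convexOn hτ _ _ _ _ _) (not_lt.1 hω1) (fun y => ?_)
      (fun g hgT => ?_))) hωδ
    · refine le_trans (le_of_eq ?_) (hω _ _)
      congr 1
      · rw [smul_smul, inv_mul_cancel₀ hs, one_smul, add_sub_cancel]
      · rw [smul_smul, inv_mul_cancel₀ hs, one_smul, WithLp.toLp_ofLp, add_sub_cancel]
    · rw [cqrObjective_sub_quad_eq hf hK hC]
      refine (Finset.abs_sum_le_sum_abs _ _).trans ?_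
      calc _ ≤ ∑ _k : Fin K, η / K :=
            Finset.sum_le_sum fun k _ => (not_le.1 (hω2 g hgT k)).le
        _ = η := by
            rw [Finset.sum_const, Finset.card_univ, Fintype.card_fin, nsmul_eq_mul]
            field_simp
  calc _ ≤ P.real exc :=
        ENNReal.toReal_mono (measure_ne_top _ _) (measure_mono_ae hsub)
    _ ≤ P.real small + P.real (⋃ g ∈ T, ⋃ k, bad g k n) := measureReal_union_le _ _
    _ ≤ P.real small + ∑ g ∈ T, ∑ k, P.real (bad g k n) := by
        gcongr
        exact (measureReal_biUnion_finset_le _ _).trans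
          (Finset.sum_le_sum fun g _ => measureReal_iUnion_fintype_le _)
    _ < r := by linarith

end Asymptotics

/-! ### Limit law and conclusion -/

/-- Asymptotic normality of the slope part of the centre of the quadratic approximation. -/
theorem tendstoInDistribution_cqrScoreCenter_snd {Ω : Type*} [MeasurableSpace Ω] {P : Measure Ω}
    [IsProbabilityMeasure P] {p K : ℕ} {τ : Fin K → ℝ} {μ : Measure ℝ} [IsProbabilityMeasure μ]
    {f : ℝ → ℝ} {ε : ℕ → Ω → ℝ} {X : (n : ℕ) → Matrix (Fin n) (Fin p) ℝ}
    {C : Matrix (Fin p) (Fin p) ℝ} {b : Fin K → ℝ}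
    (hτ : ∀ k, τ k ∈ Set.Ioo (0 : ℝ) 1) (hb : ∀ k, cdf μ (b k) = τ k) (hf : ∀ t, 0 < f t)
    (hindep : iIndepFun ε P) (hlaw : ∀ i, HasLaw (ε i) μ P) (hC : C.PosDef)
    (hX : Tendsto (fun n : ℕ => (1 / (n : ℝ)) • ((X n)ᵀ * X n)) atTop (𝓝 C))
    (hF : LocalExpansion X C (cdf μ) f)
    (hS : (((∑ k, ∑ l, min (τ k) (τ l) * (1 - max (τ k) (τ l))) /
      (∑ k, f (b k)) ^ 2) • C⁻¹).PosSemidef) :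
    TendstoInDistribution
      (fun (n : ℕ) ω => WithLp.toLp 2 (cqrScoreCenter τ b f C (X n) (fun i => ε i ω)).2) atTop
      (id : EuclideanSpace ℝ (Fin p) → EuclideanSpace ℝ (Fin p)) (fun _ => P)
      (multivariateGaussian 0 (((∑ k, ∑ l, min (τ k) (τ l) * (1 - max (τ k) (τ l))) /
        (∑ k, f (b k)) ^ 2) • C⁻¹)) := by
  have hm : ∀ n : ℕ, AEMeasurable
      (fun ω => WithLp.toLp 2 (cqrScoreCenter τ b f C (X n) (fun i => ε i ω)).2) P := by
    intro n
    have hε : ∀ k i, AEMeasurable (fun ω => quantileScore τ b k (ε i ω)) P := fun k i =>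
      (measurable_quantileScore k).comp_aemeasurable (hlaw i).aemeasurable
    have hmul : Continuous fun h : Fin n → ℝ => C⁻¹ *ᵥ ((X n)ᵀ *ᵥ h) :=
      continuous_const.matrix_mulVec (continuous_const.matrix_mulVec continuous_id)
    have hsmul : Continuous fun h : Fin n → ℝ =>
        -(∑ k, f (b k))⁻¹ • (C⁻¹ *ᵥ ((X n)ᵀ *ᵥ h)) := by fun_prop
    have hcont := (PiLp.continuous_toLp 2 (fun _ : Fin p => ℝ)).comp hsmul
    exact hcont.measurable.comp_aemeasurable (aemeasurable_pi_lambda _ fun i =>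
      (Finset.aemeasurable_fun_sum _ fun k _ => hε k i).const_mul _)
  refine ⟨hm, by fun_prop, ?_⟩
  refine ProbabilityMeasure.tendsto_iff_tendsto_charFun.2 fun t => ?_
  simp only [ProbabilityMeasure.coe_mk, Measure.map_id]
  rw [charFun_multivariateGaussian hS]
  set w : Fin p → ℝ := -(∑ k, f (b k))⁻¹ • (C⁻¹ *ᵥ t.ofLp) with hw
  have hchar : ∀ n : ℕ, charFun (P.map fun ω => WithLp.toLp 2
      (cqrScoreCenter τ b f C (X n) (fun i => ε i ω)).2) t =
      charFun (P.map fun ω => ∑ i, X n i ⬝ᵥ w / √(n : ℝ) * ∑ k, quantileScore τ b k (ε i ω)) 1 := by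
    intro n
    have hin : ∀ ω, inner ℝ (WithLp.toLp 2 (cqrScoreCenter τ b f C (X n) (fun i => ε i ω)).2) t =
        ∑ i, X n i ⬝ᵥ w / √(n : ℝ) * ∑ k, quantileScore τ b k (ε i ω) := by
      intro ω
      rw [EuclideanSpace.inner_eq_star_dotProduct]
      simp only [star_trivial]
      exact dotProduct_cqrCenter_snd (fun k => f (b k)) hC _ (X n) _ _ _
    have hm' : AEMeasurable (fun ω => ∑ i, X n i ⬝ᵥ w / √(n : ℝ) *
        ∑ k, quantileScore τ b k (ε i ω)) P := by
      simp only [← hin]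
      exact (hm n).inner_const
    rw [charFun_apply, charFun_apply_real, integral_map (hm n) (by fun_prop),
      integral_map hm' (by fun_prop)]
    simp only [hin, Complex.ofReal_one, one_mul]
  have hscore : ∀ k, Integrable (quantileScore τ b k) μ := fun k =>
    Integrable.of_bound (C := 1) (by fun_prop) (ae_of_all _ fun x => abs_quantileScore_le hτ k x)
  have hlim := tendsto_charFun_map_sum hindep hlaw
    (h := fun x => ∑ k, quantileScore τ b k x) (by fun_prop) (B := K)
    (fun x => (Finset.abs_sum_le_sum_abs _ _).trans
      ((Finset.sum_le_sum fun k _ => abs_quantileScore_le hτ k x).trans (by simp)))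
    (by
      rw [integral_finsetSum _ fun k _ => hscore k]
      exact Finset.sum_eq_zero fun k _ => integral_quantileScore hb k)
    (tendsto_sum_sq_dotProduct hX w)
    (fun δ hδ => hF.eventually_abs_dotProduct_le hX hf w hδ)
  simp only [hchar]
  convert hlim using 2
  rw [integral_sq_sum_quantileScore hτ hb, inner_zero_right, Complex.ofReal_zero, zero_mul,
    zero_sub, ← Complex.ofReal_ofNat, ← Complex.ofReal_div, ← Complex.ofReal_neg,
    ← Complex.ofReal_exp]
  congr 3
  -- The direction `w` carries `C⁻¹` twice; the `C` between cancels one, leaving the sandwich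
  -- covariance as a multiple of `C⁻¹`.
  have hCw : w ⬝ᵥ (C *ᵥ w) = (∑ k, f (b k))⁻¹ ^ 2 * (t.ofLp ⬝ᵥ (C⁻¹ *ᵥ t.ofLp)) := by
    rw [hw, Matrix.mulVec_smul, Matrix.mulVec_mulVec,
      Matrix.mul_nonsing_inv C ((Matrix.isUnit_iff_isUnit_det C).1 hC.isUnit), Matrix.one_mulVec,
      dotProduct_smul, smul_dotProduct, dotProduct_comm, smul_eq_mul, smul_eq_mul]
    ring
  rw [hCw, Matrix.smul_mulVec, dotProduct_smul, smul_eq_mul]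
  ring

theorem theorem2p1 {Ω : Type*} [MeasurableSpace Ω] (P : Measure Ω) [IsProbabilityMeasure P]
    {p K : ℕ} (hK : 0 < K)
    -- quantile levels
    (τ : Fin K → ℝ) (hτ_mono : StrictMono τ) (hτ : ∀ k, τ k ∈ Set.Ioo (0 : ℝ) 1)
    -- the error law, with a nowhere vanishing density
    (μ : Measure ℝ) [IsProbabilityMeasure μ] (f : ℝ → ℝ) (hf_meas : Measurable f)
    (hf_pos : ∀ t, 0 < f t) (hf : μ = volume.withDensity (fun t => ENNReal.ofReal (f t)))
    -- independent errors with this law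
    (ε : ℕ → Ω → ℝ) (hε_indep : iIndepFun ε P) (hε_law : ∀ i, HasLaw (ε i) μ P)
    -- the designs and the two regularity conditions
    (X : (n : ℕ) → Matrix (Fin n) (Fin p) ℝ) (C : Matrix (Fin p) (Fin p) ℝ) (hC : C.PosDef)
    (hX : Tendsto (fun n : ℕ => (1 / (n : ℝ)) • ((X n)ᵀ * X n)) atTop (𝓝 C))
    (hF : LocalExpansion X C (cdf μ) f)
    -- the true coefficients and the estimators
    (βstar : EuclideanSpace ℝ (Fin p))
    (bhat : ℕ → Ω → Fin K → ℝ) (βhat : ℕ → Ω → EuclideanSpace ℝ (Fin p))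
    (hβhat_meas : ∀ n, AEMeasurable (βhat n) P)
    (hmin : ∀ n, ∀ᵐ ω ∂P, IsCQRMinimizer τ (X n)
      (linearResponse (X n) βstar (fun i => ε i ω)) (bhat n ω) (βhat n ω)) :
    -- root-n consistency
    (∀ δ : ℝ, 0 < δ → ∃ M : ℝ, ∀ᶠ n : ℕ in atTop,
      P.real {ω | M < ‖√(n : ℝ) • (βhat n ω - βstar)‖} ≤ δ) ∧
    -- asymptotic normality
    (cqrCovariance τ C μ f).PosDef ∧
    TendstoInDistribution (fun (n : ℕ) ω => √(n : ℝ) • (βhat n ω - βstar)) atTop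
      (id : EuclideanSpace ℝ (Fin p) → EuclideanSpace ℝ (Fin p)) (fun _ => P)
      (multivariateGaussian 0 (cqrCovariance τ C μ f)) := by
  have hatoms : NullSingletonClass μ := by
    rw [hf]; infer_instance
  have hb : ∀ k, cdf μ (quantile μ (τ k)) = τ k := fun k => cdf_quantile μ (hτ k)
  have hKne : Nonempty (Fin K) := ⟨⟨0, hK⟩⟩
  have hdens : 0 < ∑ k, f (quantile μ (τ k)) :=
    Finset.sum_pos (fun k _ => hf_pos _) Finset.univ_nonempty
  have hvar : 0 < ∑ k, ∑ l, min (τ k) (τ l) * (1 - max (τ k) (τ l)) :=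
    Finset.sum_pos (fun k _ => Finset.sum_pos (fun l _ => mul_pos (lt_min (hτ k).1 (hτ l).1)
      (sub_pos.2 (max_lt (hτ k).2 (hτ l).2))) Finset.univ_nonempty) Finset.univ_nonempty
  have hS : (cqrCovariance τ C μ f).PosDef := hC.inv.smul (div_pos hvar (by positivity))
  set b : Fin K → ℝ := fun k => quantile μ (τ k)
  set m : ℕ → Ω → (Fin K → ℝ) × (Fin p → ℝ) :=
    fun n ω => cqrScoreCenter τ b f C (X n) (fun i => ε i ω)
  have hclose := fun δ (hδ : 0 < δ) => tendsto_measureReal_le_norm_sub_cqrScoreCenter hK hτ hb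
    hf_pos hε_indep hε_law hC hX hF βstar bhat βhat hmin hδ
  -- The approximation was proved in the sup norm, while the conclusion uses the Euclidean norm.
  obtain ⟨c, hc, hcn⟩ : ∃ c : ℝ, 0 < c ∧ ∀ v : Fin p → ℝ, ‖WithLp.toLp 2 v‖ ≤ c * ‖v‖ := by
    obtain ⟨c, hc, h⟩ := (PiLp.continuousLinearEquiv 2 ℝ
      (fun _ : Fin p => ℝ)).symm.toContinuousLinearMap.bound
    exact ⟨c, hc, h⟩
  have hnorm : ∀ (n : ℕ) ω, ‖√(n : ℝ) • (βhat n ω - βstar) - WithLp.toLp 2 (m n ω).2‖ ≤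
      c * ‖(√(n : ℝ) • (bhat n ω - b), √(n : ℝ) • (βhat n ω - βstar).ofLp) - m n ω‖ := by
    intro n ω
    refine (hcn (√(n : ℝ) • (βhat n ω - βstar).ofLp - (m n ω).2)).trans ?_
    gcongr
    exact norm_snd_le ((√(n : ℝ) • (bhat n ω - b), √(n : ℝ) • (βhat n ω - βstar).ofLp) - m n ω)
  refine ⟨fun δ hδ => ?_, hS, ?_⟩
  · obtain ⟨M, hM⟩ := exists_eventually_measureReal_lt_norm_cqrScoreCenter (f := f) hτ hb hε_indep
      hε_law hC hX (half_pos hδ)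
    refine ⟨c * (M + 1), ?_⟩
    filter_upwards [hM, (hclose 1 one_pos).eventually (gt_mem_nhds (half_pos hδ))] with n h1 h2
    have hsub : {ω | c * (M + 1) < ‖√(n : ℝ) • (βhat n ω - βstar)‖} ⊆
        {ω | M < ‖m n ω‖} ∪ {ω | 1 ≤
          ‖(√(n : ℝ) • (bhat n ω - b), √(n : ℝ) • (βhat n ω - βstar).ofLp) - m n ω‖} := by
      intro ω hω
      by_contra hcon
      simp only [Set.mem_union, Set.mem_ofPred_eq, not_or, not_lt, not_le] at hcon hω
      have e1 := hnorm n ω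
      have e2 := hcn (m n ω).2
      have e3 := norm_snd_le (m n ω)
      have e4 := norm_le_norm_add_norm_sub' (√(n : ℝ) • (βhat n ω - βstar))
        (WithLp.toLp 2 (m n ω).2)
      have e5 : c * ‖(m n ω).2‖ ≤ c * M := by gcongr; exact e3.trans hcon.1
      have e6 := mul_le_mul_of_nonneg_left hcon.2.le hc.le
      linarith
    exact (measureReal_mono hsub).trans ((measureReal_union_le _ _).trans (by linarith))
  -- Slutsky: the estimation error and the slope centre differ by a term tending to 0 in
  -- probability.
  · refine tendstoInDistribution_of_tendstoInMeasure_sub _ _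
      (tendstoInDistribution_cqrScoreCenter_snd hτ hb hf_pos hε_indep hε_law hC hX hF
        hS.posSemidef) ?_ (fun n => by
        have := hβhat_meas n
        fun_prop)
    rw [tendstoInMeasure_iff_measureReal_norm]
    intro r hr
    refine squeeze_zero (fun n => measureReal_nonneg) (fun n => measureReal_mono ?_)
      (hclose (r / c) (by positivity))
    intro ω hω
    simp only [Set.mem_ofPred_eq, Pi.sub_apply, Pi.zero_apply, sub_zero] at hω ⊢
    rw [div_le_iff₀' hc]
    exact hω.trans (hnorm n ω)
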